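/- Let $k,p\ge 0$ be integers and put $n=2k+1$, $\beta=(k+1,\dots,k+1)\in\mathbb N_0^p$. Let $\Omega=\prod_{i=1}^p[a_i,b_i]\subset\mathbb R^p$ be a closed rectangle with a rectangular grid: for each $i$, nodes $a_i=t_{i,0}<t_{i,1}<\dots<t_{i,N_i}=b_i$, $N_i\ge 1$ (not necessarily equidistant). The grid points are $x_m=(t_{1,m_1},\dots,t_{p,m_p})$, and the cells are the products $Q=\prod_i[t_{i,c_i},t_{i,c_i+1}]$, with interiors $Q^\circ$. Partial derivatives at points of $\partial\Omega$ are one-sided where necessary. *Interpolant.* Given data $d=(d_{m,\alpha})$, $\alpha\in\{0,\dots,k\}^p$, let $\mathcal H_d:\Omega\to\mathbb R$ be the function which on each cell $Q$ is the polynomial of degree $\le n$ in each variable given by $$\sum_{q\in\{0,1\}^p}\ \sum_{\alpha\in\{0,\dots,k\}^p} d_{c+q,\alpha}\prod_{i=1}^p(\Delta x_i)^{\alpha_i}\,w^{q_i}_{\alpha_i}(\xi_i),\qquad \Delta x_i=t_{i,c_i+1}-t_{i,c_i},\quad \xi_i=\frac{x_i-t_{i,c_i}}{\Delta x_i},$$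 where $w^{q}_{a}$ ($q\in\{0,1\}$, $0\le a\le k$) is the univariate polynomial of degree $\le n$ with $\frac{d^{a'}}{dx^{a'}}w^q_a(q')=\delta_{aa'}\delta_{qq'}$ for $q'\in\{0,1\}$, $0\le a'\le k$. For a function $\varphi:\Omega\to\mathbb R$ put $\mathcal H_\varphi=\mathcal H_d$ with $d_{m,\alpha}=\partial^\alpha\varphi(x_m)$. *Admissible functions.* For $r\in\mathbb N_0\cup\{\infty\}$, say that $\psi:\Omega\to\mathbb R$ is cellwise $C^r$ if it is $C^r$ in $Q^\circ$ for every cell $Q$, and that $\psi$ matches the data $d$ if for every cell $Q$, every vertex $x_m$ of $Q$ and every $\alpha\in\{0,\dots,k\}^p$ one has $\partial^\alpha\psi(x)\to d_{m,\alpha}$ as $x\to x_m$ in $Q^\circ$. *Stability functional.* $\mathcal F[\psi]=\int_\Omega(\partial^\beta\psi)^2\,dx\in[0,\infty]$. **Theorem.** Let $\varphi:\Omega\to\mathbb R$ be cellwise $C^{p(k+1)}$ and match its own grid data $d_{m,\alpha}=\partial^\alpha\varphi(x_m)$ (this holds, for example, for every $\varphi\in C^{p(k+1)}(\Omega)$).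 Then: 1. $\mathcal H_\varphi$ is cellwise $C^\infty$, matches the data $d$, satisfies $\partial^\alpha\mathcal H_\varphi(x_m)=\partial^\alpha\varphi(x_m)$ for all grid points $x_m$ and all $\alpha\in\{0,\dots,k\}^p$, and $\mathcal F[\mathcal H_\varphi]<\infty$. 2. $\mathcal F[\mathcal H_\varphi]\le\mathcal F[\varphi]$. 3. $\mathcal H_\varphi$ minimizes $\mathcal F$ among the cellwise smooth functions with the same data: $\mathcal F[\mathcal H_\varphi]\le\mathcal F[\psi]$ for every cellwise $C^{p(k+1)}$ function $\psi$ that matches the data $d$. 4. For every cell $Q$ on which $\partial^\beta\varphi$ is integrable, the function $\partial^\beta\mathcal H_\varphi\cdot\partial^\beta(\varphi-\mathcal H_\varphi)$ is integrable on $Q$ and $$\int_Q\partial^\beta\mathcal H_\varphi\;\partial^\beta(\varphi-\mathcal H_\varphi)\,dx=0 .$$ -/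

import Mathlib

open scoped Topology ContDiff Polynomial

noncomputable section

/-- A rectangular (tensor product) grid in `ℝ^p`: along the `i`-th axis there are `numCells i ≥ 1`
cells, cut out by the nodes `node i 0 < node i 1 < ⋯ < node i (numCells i)`.
The spacing may be uniform or not. -/
structure RectGrid (p : ℕ) where
  /-- number of cells along each axis -/
  numCells : Fin p → ℕ
  numCells_pos : ∀ i, 0 < numCells i
  /-- the coordinates of the grid hyperplanes perpendicular to each axis -/
  node : ∀ i, Fin (numCells i + 1) → ℝ
  node_strictMono : ∀ i, StrictMono (node i)

namespace RectGrid

variable {p : ℕ} (G : RectGrid p)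

/-- Labels `m` of grid points. -/
abbrev Index : Type := ∀ i, Fin (G.numCells i + 1)

/-- Labels `c` of grid cells (the label of the vertex with the lowest components). -/
abbrev Cell : Type := ∀ i, Fin (G.numCells i)

/-- The grid point `x_m`. -/
def point (m : G.Index) : Fin p → ℝ := fun i => G.node i (m i)

/-- The lower corner of the domain. -/
def lo : Fin p → ℝ := fun i => G.node i 0

/-- The upper corner of the domain. -/
def hi : Fin p → ℝ := fun i => G.node i (Fin.last _)

/-- The computational domain `Ω`, a closed `p`-rectangle. -/
def domain : Set (Fin p → ℝ) := Set.univ.pi fun i => Set.Icc (G.lo i) (G.hi i)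

/-- The label `c + q` of the vertex with index `q ∈ {0,1}^p` of the cell `c`. -/
def vertex (c : G.Cell) (q : Fin p → Fin 2) : G.Index :=
  fun i => ⟨(c i : ℕ) + (q i : ℕ), by have := (c i).isLt; have := (q i).isLt; omega⟩

/-- Lower corner of the cell `c`. -/
def cellLo (c : G.Cell) : Fin p → ℝ := fun i => G.node i (c i).castSucc

/-- Upper corner of the cell `c`. -/
def cellHi (c : G.Cell) : Fin p → ℝ := fun i => G.node i (c i).succ

/-- The closed cell `Q`. -/
def closedCell (c : G.Cell) : Set (Fin p → ℝ) :=
  Set.univ.pi fun i => Set.Icc (G.cellLo c i) (G.cellHi c i)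

/-- The interior of the cell. -/
def openCell (c : G.Cell) : Set (Fin p → ℝ) :=
  Set.univ.pi fun i => Set.Ioo (G.cellLo c i) (G.cellHi c i)

/-- The partial derivative `∂_i f` of a function on `Ω` (at a point of `∂Ω` where the line in the
direction `x_i` leaves `Ω` it is the one-sided derivative). -/
def pderiv (i : Fin p) (f : (Fin p → ℝ) → ℝ) : (Fin p → ℝ) → ℝ := fun x =>
  derivWithin (fun s => f (Function.update x i s)) (Set.Icc (G.lo i) (G.hi i)) (x i)

/-- The mixed partial derivative `∂^α f = ∂_1^{α_1} ⋯ ∂_p^{α_p} f` of a function on `Ω`. -/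
def mixedDeriv (α : Fin p → ℕ) (f : (Fin p → ℝ) → ℝ) : (Fin p → ℝ) → ℝ :=
  (List.finRange p).foldr (fun i g => (G.pderiv i)^[α i] g) f

/-- Grid data: a number for every grid point and every `α ∈ {0,…,k}^p`. -/
abbrev Data (k : ℕ) : Type := G.Index → (Fin p → Fin (k + 1)) → ℝ

/-- The data `∂^α φ(x_m)`, `α ∈ {0,…,k}^p`, of a function `φ`. -/
def gridData (k : ℕ) (φ : (Fin p → ℝ) → ℝ) : G.Data k := fun m α =>
  G.mixedDeriv (fun i => (α i : ℕ)) φ (G.point m)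

/-- `ψ` is of class `C^r` inside every grid cell. -/
def CellwiseSmooth (r : WithTop ℕ∞) (ψ : (Fin p → ℝ) → ℝ) : Prop :=
  ∀ c : G.Cell, ContDiffOn ℝ r ψ (G.openCell c)

/-- `ψ` has the grid data `d`, seen from inside each cell: at every vertex of every cell, and for
every `α ∈ {0,…,k}^p`, the limit of `∂^α ψ` from inside of that cell is the prescribed number. -/
def MatchesData (k : ℕ) (d : G.Data k) (ψ : (Fin p → ℝ) → ℝ) : Prop :=
  ∀ (c : G.Cell) (q : Fin p → Fin 2) (α : Fin p → Fin (k + 1)),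
    Filter.Tendsto (G.mixedDeriv (fun i => (α i : ℕ)) ψ)
      (𝓝[G.openCell c] G.point (G.vertex c q)) (𝓝 (d (G.vertex c q) α))

/-- The univariate Hermite basis polynomial `w_{n,a}^q` with `n = 2k+1`: of degree at most `n`, its
derivative of order `a` at `q` is `1`, and all its other derivatives of order `≤ k` at the points
`0`, `1` vanish (`hermiteBasis_natDegree_le` and `hermiteBasis_eval`). -/
def hermiteBasis (k a : ℕ) (q : Fin 2) : ℝ[X] :=
  let w : ℝ[X] := Polynomial.C ((a.factorial : ℝ)⁻¹) * Polynomial.X ^ a *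
    (1 - Polynomial.X) ^ (k + 1) *
    ∑ j ∈ Finset.range (k + 1 - a), Polynomial.C (((k + j).choose k : ℕ) : ℝ) * Polynomial.X ^ j
  if q = 0 then w else (-1) ^ a * w.comp (1 - Polynomial.X)

/-- The part of `hermiteBasis` at `q = 0`. -/
theorem hermiteBasis_zero_coeff (k a b : ℕ) (ha : a ≤ k) (hb : b ≤ k) :
    (hermiteBasis k a 0).coeff b = if a = b then (a.factorial : ℝ)⁻¹ else 0 := by
  have key : ∀ m ≤ k - a, ((1 - Polynomial.X : ℝ[X]) ^ (k + 1) * ∑ j ∈ Finset.range (k + 1 - a),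
      Polynomial.C (((k + j).choose k : ℕ) : ℝ) * Polynomial.X ^ j).coeff m
      = if m = 0 then 1 else 0 := by
    intro m hm
    have h1 : ((PowerSeries.mk fun n => (Nat.choose (k + n) k : ℝ)) *
        (1 - PowerSeries.X) ^ (k + 1)) = 1 :=
      (PowerSeries.invOneSubPow_val_succ_eq_mk_add_choose ℝ k) ▸
        (PowerSeries.invOneSubPow ℝ (k + 1)).val_inv
    have h2 := congrArg (PowerSeries.coeff m) h1
    rw [mul_comm, PowerSeries.coeff_mul, PowerSeries.coeff_one] at h2
    rw [Polynomial.coeff_mul, ← h2]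
    refine Finset.sum_congr rfl fun x hx => ?_
    have hx' := Finset.HasAntidiagonal.mem_antidiagonal.1 hx
    congr 1
    · rw [← Polynomial.coeff_coe]; simp
    · simp only [Polynomial.finsetSum_coeff, Polynomial.coeff_C_mul_X_pow, PowerSeries.coeff_mk]
      rw [Finset.sum_eq_single x.2]
      · simp
      · intro j _ hj; simp [Ne.symm hj]
      · intro h; exact absurd (Finset.mem_range.2 (by omega)) h
  simp only [hermiteBasis, if_true, mul_assoc, Polynomial.coeff_C_mul]
  rw [Polynomial.coeff_X_pow_mul']
  rcases lt_trichotomy a b with h | h | h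
  · rw [if_pos h.le, key _ (by omega), if_neg (by omega), if_neg h.ne]; simp
  · subst h; rw [if_pos le_rfl, key _ (by omega)]; simp
  · rw [if_neg (by omega), if_neg (by omega)]; simp

theorem hermiteBasis_eval (k a b : ℕ) (q r : Fin 2) (ha : a ≤ k) (hb : b ≤ k) :
    (Polynomial.derivative^[b] (hermiteBasis k a q)).eval ((r : ℕ) : ℝ) =
      if a = b ∧ q = r then 1 else 0 := by
  have hflip : hermiteBasis k a 1 = (-1) ^ a * (hermiteBasis k a 0).comp (1 - Polynomial.X) := by
    simp [hermiteBasis]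
  have h0 : (Polynomial.derivative^[b] (hermiteBasis k a 0)).eval 0 = if a = b then 1 else 0 := by
    rw [← Polynomial.coeff_zero_eq_eval_zero, Polynomial.coeff_iterate_derivative, zero_add,
      hermiteBasis_zero_coeff k a b ha hb, Nat.descFactorial_self]
    split_ifs with h
    · subst h; simp [Nat.factorial_ne_zero]
    · simp
  have h1 : (Polynomial.derivative^[b] (hermiteBasis k a 0)).eval 1 = 0 := by
    have hc : ((hermiteBasis k a 0).comp (1 - Polynomial.X)).coeff b = 0 := by
      have : (hermiteBasis k a 0).comp (1 - Polynomial.X) = Polynomial.X ^ (k + 1) *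
          ((Polynomial.C ((a.factorial : ℝ)⁻¹) * Polynomial.X ^ a *
          ∑ j ∈ Finset.range (k + 1 - a), Polynomial.C (((k + j).choose k : ℕ) : ℝ) *
            Polynomial.X ^ j).comp (1 - Polynomial.X)) := by
        simp only [hermiteBasis, if_true, Polynomial.mul_comp, Polynomial.pow_comp,
          Polynomial.sub_comp, Polynomial.one_comp, Polynomial.X_comp, sub_sub_cancel]
        ring
      rw [this, Polynomial.coeff_X_pow_mul', if_neg (by omega)]
    have hd : (Polynomial.derivative^[b] ((hermiteBasis k a 0).comp (1 - Polynomial.X))).eval 0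
        = 0 := by
      rw [← Polynomial.coeff_zero_eq_eval_zero, Polynomial.coeff_iterate_derivative, zero_add, hc]
      simp
    rw [Polynomial.iterate_derivative_comp_one_sub_X] at hd
    simpa [Polynomial.eval_mul, Polynomial.eval_comp] using hd
  have hder : Polynomial.derivative^[b] (hermiteBasis k a 1) = Polynomial.C ((-1) ^ a) *
      ((-1) ^ b * (Polynomial.derivative^[b] (hermiteBasis k a 0)).comp (1 - Polynomial.X)) := by
    rw [hflip, ← Polynomial.iterate_derivative_comp_one_sub_X,
      ← Polynomial.iterate_derivative_C_mul]
    simp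
  fin_cases q <;> fin_cases r
  · simpa using h0
  · simpa using h1
  · simp [hder, Polynomial.eval_comp, h1]
  · simp only [Fin.mk_one, hder, Polynomial.eval_mul, Polynomial.eval_comp]
    simp [h0]
    split_ifs with h
    · subst h; rw [← mul_pow]; simp
    · rfl

theorem hermiteBasis_natDegree_le (k a : ℕ) (q : Fin 2) (ha : a ≤ k) :
    (hermiteBasis k a q).natDegree ≤ 2 * k + 1 := by
  have h1 : (1 - Polynomial.X : ℝ[X]).natDegree ≤ 1 := by compute_degree
  have h0 : (hermiteBasis k a 0).natDegree ≤ 2 * k + 1 := by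
    have hs : (∑ j ∈ Finset.range (k + 1 - a), Polynomial.C (((k + j).choose k : ℕ) : ℝ) *
        Polynomial.X ^ j).natDegree ≤ k - a :=
      Polynomial.natDegree_sum_le_of_forall_le _ _ fun j hj =>
        (Polynomial.natDegree_C_mul_X_pow_le _ _).trans (by have := Finset.mem_range.1 hj; omega)
    have hp : ((1 - Polynomial.X : ℝ[X]) ^ (k + 1)).natDegree ≤ k + 1 :=
      (Polynomial.natDegree_pow_le_of_le _ h1).trans (by omega)
    simp only [hermiteBasis, if_true]
    refine (Polynomial.natDegree_mul_le_of_le (Polynomial.natDegree_mul_le_of_le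
      (Polynomial.natDegree_C_mul_X_pow_le _ a) hp) hs).trans (by omega)
  fin_cases q
  · exact h0
  · have hflip : hermiteBasis k a 1 =
        Polynomial.C ((-1) ^ a) * (hermiteBasis k a 0).comp (1 - Polynomial.X) := by
      simp [hermiteBasis]
    simp only [Fin.mk_one, hflip]
    refine (Polynomial.natDegree_C_mul_le _ _).trans (Polynomial.natDegree_comp_le.trans ?_)
    nlinarith

/-- The `p`-`n` polynomial (`n = 2k+1`) that interpolates the data `d` at the vertices of the
cell `c`, as a sum of tensor products of univariate basis polynomials in the relative coordinates
`ξ_i = (x_i - a_i) / Δx_i`. -/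
def cellInterpolant (k : ℕ) (d : G.Data k) (c : G.Cell) (x : Fin p → ℝ) : ℝ :=
  ∑ q : Fin p → Fin 2, ∑ α : Fin p → Fin (k + 1), d (G.vertex c q) α *
    ∏ i, (G.cellHi c i - G.cellLo c i) ^ (α i : ℕ) *
      (hermiteBasis k (α i) (q i)).eval
        ((x i - G.cellLo c i) / (G.cellHi c i - G.cellLo c i))

open Classical in
/-- The global interpolant of the data `d`: in every cell it is the `p`-`n` polynomial that
interpolates the data at the vertices of this cell. (At a point on the common boundary of several
cells the polynomials of these cells have the same value, so it does not matter which is taken.) -/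
def interpolant (k : ℕ) (d : G.Data k) (x : Fin p → ℝ) : ℝ :=
  if h : ∃ c : G.Cell, x ∈ G.closedCell c then G.cellInterpolant k d h.choose x else 0

/-- The global interpolant `H_φ` of a function `φ`. -/
def hermite (k : ℕ) (φ : (Fin p → ℝ) → ℝ) : (Fin p → ℝ) → ℝ :=
  G.interpolant k (G.gridData k φ)

/-- The multi-index `β = (k+1,…,k+1)`. -/
def beta (p k : ℕ) : Fin p → ℕ := fun _ => k + 1

/-- The stability functional `F[φ] = ∫_Ω (∂^β φ)^2`, with values in `[0,∞]`. -/
def stability (k : ℕ) (φ : (Fin p → ℝ) → ℝ) : ENNReal :=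
  ∫⁻ x in G.domain, ENNReal.ofReal ((G.mixedDeriv (beta p k) φ x) ^ 2)

theorem contDiffOn_pderiv (i : Fin p) (f : (Fin p → ℝ) → ℝ) (n : ℕ)
    (hf : ContDiffOn ℝ ((n + 1 : ℕ) : WithTop ℕ∞) f G.domain) :
    ContDiffOn ℝ (n : WithTop ℕ∞) (G.pderiv i f) G.domain := by
  have hlt : ∀ j, G.lo j < G.hi j := fun j => G.node_strictMono j (by
    rw [Fin.lt_def]; exact G.numCells_pos j)
  have hu : UniqueDiffOn ℝ G.domain :=
    UniqueDiffOn.univ_pi fun j => uniqueDiffOn_Icc (hlt j)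
  have h1 : ContDiffOn ℝ (n : WithTop ℕ∞)
      (fun x => fderivWithin ℝ f G.domain x (Pi.single i 1)) G.domain :=
    (hf.fderivWithin hu (m := (n : WithTop ℕ∞)) (by exact_mod_cast le_rfl)).clm_apply
      contDiffOn_const
  refine h1.congr fun x hx => ?_
  have hxi : x i ∈ Set.Icc (G.lo i) (G.hi i) := hx i (Set.mem_univ i)
  have hd : HasFDerivWithinAt f (fderivWithin ℝ f G.domain x) G.domain
      (Function.update x i (x i)) := by
    rw [Function.update_eq_self]
    exact (hf.differentiableOn (by exact_mod_cast Nat.succ_ne_zero n) x hx).hasFDerivWithinAt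
  have hup : HasDerivWithinAt (Function.update x i) (Pi.single i (1 : ℝ))
      (Set.Icc (G.lo i) (G.hi i)) (x i) := (hasDerivAt_update x i (x i)).hasDerivWithinAt
  have hmaps : Set.MapsTo (Function.update x i) (Set.Icc (G.lo i) (G.hi i)) G.domain := by
    intro s hs j _
    by_cases hj : j = i
    · subst hj; simpa using hs
    · simpa [hj] using hx j (Set.mem_univ j)
  exact (hd.comp_hasDerivWithinAt (x i) hup hmaps).derivWithin
    (uniqueDiffOn_Icc (hlt i) _ hxi)

/-- Functions of class `C^{p(k+1)}` on `Ω` have well defined grid data. -/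
theorem matchesData_gridData (k : ℕ) (φ : (Fin p → ℝ) → ℝ)
    (hφ : ContDiffOn ℝ ((p * (k + 1) : ℕ) : WithTop ℕ∞) φ G.domain) :
    G.CellwiseSmooth ((p * (k + 1) : ℕ) : WithTop ℕ∞) φ ∧
      G.MatchesData k (G.gridData k φ) φ := by
  have hsub : ∀ c, G.openCell c ⊆ G.domain := fun c x hx i hi =>
    ⟨((G.node_strictMono i).monotone (Fin.zero_le _)).trans (hx i hi).1.le,
      (hx i hi).2.le.trans ((G.node_strictMono i).monotone (Fin.le_last _))⟩
  refine ⟨fun c => hφ.mono (hsub c), fun c q α => ?_⟩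
  have hit : ∀ (i : Fin p) (a n : ℕ) (f : (Fin p → ℝ) → ℝ),
      ContDiffOn ℝ ((n + a : ℕ) : WithTop ℕ∞) f G.domain →
      ContDiffOn ℝ (n : WithTop ℕ∞) ((G.pderiv i)^[a] f) G.domain := by
    intro i a
    induction a with
    | zero => intro n f hf; simpa using hf
    | succ a ih =>
      intro n f hf
      rw [Function.iterate_succ_apply']
      refine G.contDiffOn_pderiv i _ n (ih (n + 1) f ?_)
      rwa [show n + 1 + a = n + (a + 1) by ring]
  have hfold : ∀ (l : List (Fin p)) (n : ℕ),
      ContDiffOn ℝ ((n + l.length * (k + 1) : ℕ) : WithTop ℕ∞) φ G.domain →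
      ContDiffOn ℝ (n : WithTop ℕ∞)
        (l.foldr (fun i g => (G.pderiv i)^[(α i : ℕ)] g) φ) G.domain := by
    intro l
    induction l with
    | nil => intro n hn; simpa using hn
    | cons i l ih =>
      intro n hn
      refine hit i _ n _ (ih _ (hn.of_le ?_))
      have := (α i).isLt
      simp only [List.length_cons]
      exact_mod_cast (by nlinarith : n + (α i : ℕ) + l.length * (k + 1)
        ≤ n + (l.length + 1) * (k + 1))
  have hc := (hfold (List.finRange p) 0 (by simpa using hφ)).continuousOn
  have hmem : G.point (G.vertex c q) ∈ G.domain := fun i _ =>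
    ⟨(G.node_strictMono i).monotone (Fin.zero_le _),
      (G.node_strictMono i).monotone (Fin.le_last _)⟩
  exact (hc _ hmem).mono_left (nhdsWithin_mono _ (hsub c))

end RectGrid

end

/-!
Integrating by parts `k + 1` times in each variable turns `∫_Q (∏ i, P i (x i)) ∂^β u`, with `P i`
of degree at most `k`, into a linear combination of the values of `∂^α u`, `α ∈ {0,…,k}^p`, at the
vertices of the cell `Q`: the derivatives of order `k + 1` of the `P i` vanish, so that no integral
is left. For a function `ψ` that matches the data `d` and the interpolant `H` of `d`, all these
values vanish for `u = ψ - H`. On `Q`, the polynomial `∂^β H` is a sum of such products, since `H`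
has degree at most `2k + 1` in each variable; hence `∂^β H` is orthogonal to `∂^β (ψ - H)` in
`L²(Q)`, and `∫_Q (∂^β H)² ≤ ∫_Q (∂^β ψ)²` by the theorem of Pythagoras.
-/

section HermiteStability

open MeasureTheory Set Filter

section IntegrationByParts

/-- The weight with which the `j`-th derivative of `u` at the end point `![a, b] q` enters the
result of integrating `P * u⁽ⁿ⁾` by parts `n` times over `[a, b]`, where `e = (q, j)`. -/
noncomputable def boundaryCoeff {n : ℕ} (P : ℝ[X]) (a b : ℝ) (e : Fin 2 × Fin n) : ℝ :=
  (-1) ^ ((e.1 : ℕ) + 1 + (e.2.rev : ℕ)) *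
    (Polynomial.derivative^[e.2.rev] P).eval (![a, b] e.1)

theorem continuous_boundaryCoeff {n : ℕ} (P : ℝ[X]) (e : Fin 2 × Fin n) :
    Continuous fun ab : ℝ × ℝ => boundaryCoeff P ab.1 ab.2 e := by
  obtain ⟨q, j⟩ := e
  refine continuous_const.mul ((Polynomial.continuous _).comp ?_)
  fin_cases q
  exacts [continuous_fst, continuous_snd]

theorem sum_boundaryCoeff_mul_succ {n : ℕ} (P : ℝ[X]) (a b : ℝ) (u : ℕ → ℝ → ℝ) :
    ∑ e : Fin 2 × Fin (n + 1), boundaryCoeff P a b e * u e.2 (![a, b] e.1) =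
      P.eval b * u n b - P.eval a * u n a -
        ∑ e : Fin 2 × Fin n, boundaryCoeff P.derivative a b e * u e.2 (![a, b] e.1) := by
  simp only [Fintype.sum_prod_type, Fin.sum_univ_two]
  simp only [boundaryCoeff, Fin.sum_univ_castSucc, Fin.rev_castSucc, Fin.rev_last, Fin.val_succ,
    Fin.val_castSucc, Fin.val_last, Fin.val_zero, Fin.val_one, Function.iterate_succ_apply,
    Matrix.cons_val_zero, Matrix.cons_val_one, Function.iterate_zero_apply, pow_add, pow_one,
    pow_zero, mul_neg, mul_one, neg_mul, one_mul,
    neg_neg, Finset.sum_neg_distrib]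
  ring

theorem setIntegral_eval_mul_eq_sum {n : ℕ} {P : ℝ[X]} (hP : Polynomial.derivative^[n] P = 0)
    {a b : ℝ} (hab : a ≤ b) {u : ℕ → ℝ → ℝ}
    (hu : ∀ j < n, ∀ s ∈ Icc a b, HasDerivAt (u j) (u (j + 1) s) s)
    (hc : ContinuousOn (u n) (Icc a b)) :
    ∫ s in Icc a b, P.eval s * u n s =
      ∑ e : Fin 2 × Fin n, boundaryCoeff P a b e * u e.2 (![a, b] e.1) := by
  induction n generalizing P with
  | zero =>
    obtain rfl : P = 0 := hP
    simp
  | succ n ih =>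
    have hcn : ContinuousOn (u n) (Icc a b) := fun s hs =>
      (hu n n.lt_succ_self s hs).continuousAt.continuousWithinAt
    have parts := intervalIntegral.integral_mul_deriv_eq_deriv_mul (a := a) (b := b)
      (u := fun s => P.eval s) (u' := fun s => P.derivative.eval s) (v := u n) (v' := u (n + 1))
      (fun s _ => P.hasDerivAt s) (fun s hs => hu n n.lt_succ_self s (uIcc_of_le hab ▸ hs))
      (P.derivative.continuous.intervalIntegrable a b)
      (hc.mono (uIcc_of_le hab).subset).intervalIntegrable
    simp only [intervalIntegral.integral_of_le hab, ← integral_Icc_eq_integral_Ioc] at parts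
    rw [parts, ih hP (fun j hj => hu j (hj.trans n.lt_succ_self)) hcn,
      sum_boundaryCoeff_mul_succ]

/-- The vertex with index `q` of the box with lower corner `a` and upper corner `b`. -/
def corner {p : ℕ} (a b : Fin p → ℝ) (q : Fin p → Fin 2) : Fin p → ℝ := fun i => ![a i, b i] (q i)

theorem cons_val_mem_Icc {a b : ℝ} (hab : a ≤ b) (q : Fin 2) : ![a, b] q ∈ Icc a b := by
  fin_cases q
  exacts [left_mem_Icc.2 hab, right_mem_Icc.2 hab]

theorem continuous_corner {p : ℕ} (q : Fin p → Fin 2) :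
    Continuous fun ab : (Fin p → ℝ) × (Fin p → ℝ) => corner ab.1 ab.2 q := by
  refine continuous_pi fun i => ?_
  unfold corner
  generalize q i = r
  fin_cases r
  · exact (continuous_apply i).comp continuous_fst
  · exact (continuous_apply i).comp continuous_snd

/-- `g γ`, for `γ ≤ β`, behaves on `s` like the mixed partial derivative `∂^γ` of one function
`g 0`. Only the derivatives of orders `γ ≤ β`, which suffice for integrating `g β` by parts, are
constrained. -/
structure IsMixedDerivSystem {p : ℕ} (β : Fin p → ℕ) (g : (Fin p → ℕ) → (Fin p → ℝ) → ℝ)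
    (s : Set (Fin p → ℝ)) : Prop where
  continuousOn : ∀ γ ≤ β, ContinuousOn (g γ) s
  hasDerivAt : ∀ γ ≤ β, ∀ i, γ i < β i → ∀ x ∈ s,
    HasDerivAt (fun t => g γ (Function.update x i t)) (g (Function.update γ i (γ i + 1)) x) (x i)

namespace IsMixedDerivSystem

theorem mono {p : ℕ} {β : Fin p → ℕ} {g : (Fin p → ℕ) → (Fin p → ℝ) → ℝ} {s s' : Set (Fin p → ℝ)}
    (h : IsMixedDerivSystem β g s) (hs : s' ⊆ s) : IsMixedDerivSystem β g s' where
  continuousOn γ hγ := (h.continuousOn γ hγ).mono hs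
  hasDerivAt γ hγ i hi x hx := h.hasDerivAt γ hγ i hi x (hs hx)

theorem sub {p : ℕ} {β : Fin p → ℕ} {g g' : (Fin p → ℕ) → (Fin p → ℝ) → ℝ}
    {s : Set (Fin p → ℝ)} (h : IsMixedDerivSystem β g s) (h' : IsMixedDerivSystem β g' s) :
    IsMixedDerivSystem β (g - g') s where
  continuousOn γ hγ := (h.continuousOn γ hγ).sub (h'.continuousOn γ hγ)
  hasDerivAt γ hγ i hi x hx := (h.hasDerivAt γ hγ i hi x hx).sub (h'.hasDerivAt γ hγ i hi x hx)

variable {p : ℕ} {β : Fin (p + 1) → ℕ} {g : (Fin (p + 1) → ℕ) → (Fin (p + 1) → ℝ) → ℝ}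
  {s : Set (Fin (p + 1) → ℝ)} {n : ℕ} {γ : Fin p → ℕ}

theorem slice (h : IsMixedDerivSystem β g s) (hn : n ≤ β 0) (t : ℝ) :
    IsMixedDerivSystem (Fin.tail β) (fun γ y => g (Fin.cons n γ) (Fin.cons t y))
      {y | (Fin.cons t y : Fin (p + 1) → ℝ) ∈ s} where
  continuousOn γ hγ := (h.continuousOn _ (Fin.cons_le.2 ⟨hn, hγ⟩)).comp
    (Continuous.continuousOn (by fun_prop)) fun _ hy => hy
  hasDerivAt γ hγ i hi y hy := by
    simpa only [← Fin.cons_update, Fin.cons_succ] using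
      h.hasDerivAt _ (Fin.cons_le.2 ⟨hn, hγ⟩) i.succ
        (by simpa only [Fin.cons_succ, Fin.tail] using hi) _ hy

theorem continuousOn_cons (h : IsMixedDerivSystem β g s) (hn : n ≤ β 0) (hγ : γ ≤ Fin.tail β)
    (y : Fin p → ℝ) : ContinuousOn (fun t : ℝ => g (Fin.cons n γ) (Fin.cons t y))
      {t | (Fin.cons t y : Fin (p + 1) → ℝ) ∈ s} :=
  (h.continuousOn _ (Fin.cons_le.2 ⟨hn, hγ⟩)).comp (Continuous.continuousOn (by fun_prop))
    fun _ ht => ht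

theorem hasDerivAt_cons (h : IsMixedDerivSystem β g s) (hn : n < β 0) (hγ : γ ≤ Fin.tail β)
    {y : Fin p → ℝ} {t : ℝ} (ht : (Fin.cons t y : Fin (p + 1) → ℝ) ∈ s) :
    HasDerivAt (fun t : ℝ => g (Fin.cons n γ) (Fin.cons t y))
      (g (Fin.cons (n + 1) γ) (Fin.cons t y)) t := by
  simpa only [Fin.update_cons_zero, Fin.cons_zero] using
    h.hasDerivAt _ (Fin.cons_le.2 ⟨hn.le, hγ⟩) 0 (by simpa using hn) _ ht

end IsMixedDerivSystem

theorem cons_mem_Icc_iff {p : ℕ} {a b : Fin (p + 1) → ℝ} {s : ℝ} {y : Fin p → ℝ} :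
    (Fin.cons s y : Fin (p + 1) → ℝ) ∈ Icc a b ↔
      s ∈ Icc (a 0) (b 0) ∧ y ∈ Icc (Fin.tail a) (Fin.tail b) := by
  rw [mem_Icc, Fin.le_cons, Fin.cons_le, mem_Icc, mem_Icc]
  tauto

theorem setIntegral_Icc_fin_succ {E : Type*} [NormedAddCommGroup E] [NormedSpace ℝ E] {p : ℕ}
    {a b : Fin (p + 1) → ℝ} {F : (Fin (p + 1) → ℝ) → E} (hF : IntegrableOn F (Icc a b)) :
    ∫ x in Icc a b, F x = ∫ y in Icc (Fin.tail a) (Fin.tail b),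
      ∫ s in Icc (a 0) (b 0), F (Fin.cons s y) := by
  set e := (MeasurableEquiv.piFinSuccAbove (fun _ : Fin (p + 1) => ℝ) 0).symm with he
  have e_apply : ∀ z, e z = Fin.cons z.1 z.2 := fun z => by
    simp [he, MeasurableEquiv.piFinSuccAbove_symm_apply, Fin.insertNthEquiv]
  have preserves : MeasurePreserving e :=
    (volume_preserving_piFinSuccAbove (fun _ : Fin (p + 1) => ℝ) 0).symm
  have preimage : e ⁻¹' Icc a b = Icc (a 0) (b 0) ×ˢ Icc (Fin.tail a) (Fin.tail b) := by
    ext z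
    rw [mem_preimage, e_apply, cons_mem_Icc_iff, mem_prod]
  have integrable : IntegrableOn (fun z => F (e z)) (e ⁻¹' Icc a b) :=
    (preserves.integrableOn_comp_preimage e.measurableEmbedding).2 hF
  rw [preimage, IntegrableOn, Measure.volume_eq_prod, ← Measure.prod_restrict] at integrable
  rw [← preserves.setIntegral_preimage_emb e.measurableEmbedding, preimage,
    Measure.volume_eq_prod, ← Measure.prod_restrict, integral_prod_symm _ integrable]
  simp only [e_apply]

theorem continuous_prod_eval {p : ℕ} (P : Fin p → ℝ[X]) :
    Continuous fun x : Fin p → ℝ => ∏ i, (P i).eval (x i) :=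
  continuous_finsetProd _ fun i _ => (P i).continuous.comp (continuous_apply i)

/-- The sum of the boundary terms when `(∏ i, P i (x i)) * g β x` is integrated by parts `β i` times
in the variable `x i`, for every `i`, over the box with corners `a` and `b`. The term with index
`e` is taken at the vertex with index `i ↦ (e i).1` and contains the derivative of order
`i ↦ (e i).2`. -/
noncomputable def boundarySum {p : ℕ} (β : Fin p → ℕ) (P : Fin p → ℝ[X]) (a b : Fin p → ℝ)
    (g : (Fin p → ℕ) → (Fin p → ℝ) → ℝ) : ℝ :=
  ∑ e : ∀ i, Fin 2 × Fin (β i), (∏ i, boundaryCoeff (P i) (a i) (b i) (e i)) *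
    g (fun i => (e i).2) (corner a b fun i => (e i).1)

theorem boundarySum_zero {p : ℕ} (β : Fin p → ℕ) (P : Fin p → ℝ[X]) (a b : Fin p → ℝ) :
    boundarySum β P a b 0 = 0 :=
  Finset.sum_eq_zero fun _ _ => mul_zero _

theorem boundarySum_fin_zero (β : Fin 0 → ℕ) (P : Fin 0 → ℝ[X]) (a b : Fin 0 → ℝ)
    (g : (Fin 0 → ℕ) → (Fin 0 → ℝ) → ℝ) : boundarySum β P a b g = g β a := by
  simp only [boundarySum, Finset.univ_eq_empty, Finset.prod_empty, one_mul, Fintype.sum_unique]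
  exact congrArg₂ g (Subsingleton.elim _ _) (Subsingleton.elim _ _)

theorem boundarySum_fin_succ {p : ℕ} (β : Fin (p + 1) → ℕ) (P : Fin (p + 1) → ℝ[X])
    (a b : Fin (p + 1) → ℝ) (g : (Fin (p + 1) → ℕ) → (Fin (p + 1) → ℝ) → ℝ) :
    boundarySum β P a b g = ∑ e : Fin 2 × Fin (β 0), boundaryCoeff (P 0) (a 0) (b 0) e *
      boundarySum (Fin.tail β) (Fin.tail P) (Fin.tail a) (Fin.tail b)
        fun γ y => g (Fin.cons (e.2 : ℕ) γ) (Fin.cons (![a 0, b 0] e.1) y) := by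
  unfold boundarySum
  rw [← (Fin.consEquiv fun i => Fin 2 × Fin (β i)).sum_comp, Fintype.sum_prod_type]
  refine Finset.sum_congr rfl fun e₀ _ => ?_
  rw [Finset.mul_sum]
  refine Finset.sum_congr rfl fun e _ => ?_
  simp only [Fin.consEquiv, Equiv.coe_fn_mk, Fin.prod_univ_succ, Fin.cons_zero, Fin.cons_succ,
    mul_assoc]
  congr 3
  · exact funext (Fin.cases rfl fun _ => rfl)
  · exact funext (Fin.cases rfl fun _ => rfl)

theorem setIntegral_prod_eval_mul_cons {p : ℕ} {β : Fin (p + 1) → ℕ} {P : Fin (p + 1) → ℝ[X]}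
    {a b : Fin (p + 1) → ℝ} {g : (Fin (p + 1) → ℕ) → (Fin (p + 1) → ℝ) → ℝ} (hab : a 0 ≤ b 0)
    (hP : Polynomial.derivative^[β 0] (P 0) = 0) (hg : IsMixedDerivSystem β g (Icc a b))
    {y : Fin p → ℝ} (hy : y ∈ Icc (Fin.tail a) (Fin.tail b)) :
    ∫ s in Icc (a 0) (b 0), (∏ i, (P i).eval ((Fin.cons s y : Fin (p + 1) → ℝ) i)) *
        g β (Fin.cons s y) =
      ∑ e : Fin 2 × Fin (β 0), boundaryCoeff (P 0) (a 0) (b 0) e *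
        ((∏ i, (Fin.tail P i).eval (y i)) *
          g (Fin.cons (e.2 : ℕ) (Fin.tail β)) (Fin.cons (![a 0, b 0] e.1) y)) := by
  have parts := setIntegral_eval_mul_eq_sum hP hab
    (u := fun j s => g (Fin.cons j (Fin.tail β)) (Fin.cons s y))
    (fun j hj s hs => hg.hasDerivAt_cons hj le_rfl (cons_mem_Icc_iff.2 ⟨hs, hy⟩))
    ((hg.continuousOn_cons le_rfl le_rfl y).mono fun s hs => cons_mem_Icc_iff.2 ⟨hs, hy⟩)
  simp only [Fin.prod_univ_succ, Fin.cons_zero, Fin.cons_succ, Fin.cons_self_tail] at parts ⊢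
  simp only [mul_left_comm _ (∏ _, _), mul_comm (Polynomial.eval _ _) (∏ _, _), mul_assoc,
    integral_const_mul, parts, Finset.mul_sum, Fin.tail]

theorem setIntegral_prod_eval_mul_eq_boundarySum {p : ℕ} {β : Fin p → ℕ} {P : Fin p → ℝ[X]}
    {a b : Fin p → ℝ} {g : (Fin p → ℕ) → (Fin p → ℝ) → ℝ} (hab : a ≤ b)
    (hP : ∀ i, Polynomial.derivative^[β i] (P i) = 0)
    (hg : IsMixedDerivSystem β g (Icc a b)) :
    ∫ x in Icc a b, (∏ i, (P i).eval (x i)) * g β x = boundarySum β P a b g := by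
  induction p with
  | zero =>
    rw [boundarySum_fin_zero, Subsingleton.elim b a, Icc_self, integral_singleton,
      Measure.volume_pi_eq_dirac a, measureReal_def, Measure.dirac_apply_of_mem (mem_singleton a)]
    simp
  | succ p ih =>
    have habt : Fin.tail a ≤ Fin.tail b := fun i => hab i.succ
    have slices : ∀ e : Fin 2 × Fin (β 0), IsMixedDerivSystem (Fin.tail β)
        (fun γ y => g (Fin.cons (e.2 : ℕ) γ) (Fin.cons (![a 0, b 0] e.1) y))
        (Icc (Fin.tail a) (Fin.tail b)) := fun e =>
      (hg.slice e.2.isLt.le _).mono fun y hy =>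
        cons_mem_Icc_iff.2 ⟨cons_val_mem_Icc (hab 0) e.1, hy⟩
    have integrable : ∀ e : Fin 2 × Fin (β 0), IntegrableOn
        (fun y => (∏ i, (Fin.tail P i).eval (y i)) *
          g (Fin.cons (e.2 : ℕ) (Fin.tail β)) (Fin.cons (![a 0, b 0] e.1) y))
        (Icc (Fin.tail a) (Fin.tail b)) := fun e =>
      ((continuous_prod_eval _).continuousOn.mul
        ((slices e).continuousOn _ le_rfl)).integrableOn_compact isCompact_Icc
    have integrable_box : IntegrableOn (fun x => (∏ i, (P i).eval (x i)) * g β x) (Icc a b) :=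
      ((continuous_prod_eval P).continuousOn.mul
        (hg.continuousOn β le_rfl)).integrableOn_compact isCompact_Icc
    rw [setIntegral_Icc_fin_succ integrable_box,
      setIntegral_congr_fun measurableSet_Icc fun y hy =>
        setIntegral_prod_eval_mul_cons (hab 0) (hP 0) hg hy,
      integral_finsetSum _ fun e _ => (integrable e).const_mul _, boundarySum_fin_succ]
    refine Finset.sum_congr rfl fun e _ => ?_
    rw [integral_const_mul, ih (β := Fin.tail β) (P := Fin.tail P) habt (fun i => hP i.succ)
      (slices e)]

/-- Since `g` has limits only at the vertices and not along the faces, the open box is exhausted by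
closed boxes. -/
theorem setIntegral_pi_Ioo_prod_eval_mul_eq_boundarySum {p : ℕ} {β : Fin p → ℕ} {P : Fin p → ℝ[X]}
    {a b : Fin p → ℝ} {g v : (Fin p → ℕ) → (Fin p → ℝ) → ℝ} (hab : ∀ i, a i < b i)
    (hP : ∀ i, Polynomial.derivative^[β i] (P i) = 0)
    (hg : IsMixedDerivSystem β g (univ.pi fun i => Ioo (a i) (b i)))
    (hv : ∀ γ, (∀ i, γ i < β i) → ∀ q,
      Tendsto (g γ) (𝓝[univ.pi fun i => Ioo (a i) (b i)] corner a b q) (𝓝 (v γ (corner a b q))))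
    (hint : IntegrableOn (fun x => (∏ i, (P i).eval (x i)) * g β x)
      (univ.pi fun i => Ioo (a i) (b i))) :
    ∫ x in univ.pi fun i => Ioo (a i) (b i), (∏ i, (P i).eval (x i)) * g β x =
      boundarySum β P a b v := by
  set S := univ.pi fun i => Ioo (a i) (b i)
  obtain ⟨J, J_subset, lower_tendsto, upper_tendsto⟩ :=
    BoxIntegral.Box.exists_seq_mono_tendsto ⟨a, b, hab⟩
  have iUnion_J : ⋃ n, Icc (J n).lower (J n).upper = S := by
    refine (iUnion_subset J_subset).antisymm ?_
    exact (BoxIntegral.Box.iUnion_Ioo_of_tendsto J.monotone lower_tendsto upper_tendsto).ge.trans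
      (iUnion_mono fun n => BoxIntegral.Box.Ioo_subset_Icc _)
  have bounds_tendsto : Tendsto (fun n => ((J n).lower, (J n).upper)) atTop (𝓝 (a, b)) :=
    lower_tendsto.prodMk_nhds upper_tendsto
  have integrals_tendsto :=
    tendsto_setIntegral_of_monotone (s := fun n => Icc (J n).lower (J n).upper)
      (fun n => measurableSet_Icc) (fun m n hmn => BoxIntegral.Box.le_iff_Icc.1 (J.monotone hmn))
      (iUnion_J ▸ hint)
  rw [iUnion_J] at integrals_tendsto
  refine tendsto_nhds_unique integrals_tendsto (Tendsto.congr (fun n =>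
    (setIntegral_prod_eval_mul_eq_boundarySum (J n).lower_le_upper hP
      (hg.mono (J_subset n))).symm) ?_)
  refine tendsto_finsetSum _ fun e _ => Tendsto.mul (tendsto_finsetProd _ fun i _ => ?_) ?_
  · exact (((continuous_boundaryCoeff (P i) (e i)).comp (((continuous_apply i).comp
      continuous_fst).prodMk ((continuous_apply i).comp continuous_snd))).tendsto (a, b)).comp
      bounds_tendsto
  · refine (hv _ (fun i => (e i).2.isLt) _).comp (tendsto_nhdsWithin_iff.2
      ⟨((continuous_corner _).tendsto (a, b)).comp bounds_tendsto, .of_forall fun n =>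
        J_subset n ⟨fun i => ?_, fun i => ?_⟩⟩)
    exacts [(cons_val_mem_Icc ((J n).lower_le_upper i) _).1,
      (cons_val_mem_Icc ((J n).lower_le_upper i) _).2]

end IntegrationByParts

theorem ofReal_integral_le_lintegral_ofReal {α : Type*} [MeasurableSpace α] {μ : Measure α}
    {f : α → ℝ} (hf : Integrable f μ) :
    ENNReal.ofReal (∫ x, f x ∂μ) ≤ ∫⁻ x, ENNReal.ofReal (f x) ∂μ := by
  refine ENNReal.ofReal_le_of_le_toReal ?_
  rw [integral_eq_lintegral_pos_part_sub_lintegral_neg_part hf]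
  exact sub_le_self _ ENNReal.toReal_nonneg

theorem lintegral_sq_le_of_integral_mul_sub_eq_zero {α : Type*} [MeasurableSpace α]
    {μ : Measure α} {f g : α → ℝ} (hf : Integrable (fun x => f x ^ 2) μ)
    (hfg : Integrable (fun x => f x * (g x - f x)) μ) (h : ∫ x, f x * (g x - f x) ∂μ = 0) :
    ∫⁻ x, ENNReal.ofReal (f x ^ 2) ∂μ ≤ ∫⁻ x, ENNReal.ofReal (g x ^ 2) ∂μ := calc
  _ = ENNReal.ofReal (∫ x, f x ^ 2 ∂μ) :=
    (ofReal_integral_eq_lintegral_ofReal hf (.of_forall fun x => sq_nonneg _)).symm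
  _ = ENNReal.ofReal (∫ x, (f x ^ 2 + 2 * (f x * (g x - f x))) ∂μ) := by
    rw [integral_add hf (hfg.const_mul 2), integral_const_mul, h, mul_zero, add_zero]
  _ ≤ ∫⁻ x, ENNReal.ofReal (f x ^ 2 + 2 * (f x * (g x - f x))) ∂μ :=
    ofReal_integral_le_lintegral_ofReal (hf.add (hfg.const_mul 2))
  _ ≤ _ := lintegral_mono fun x => ENNReal.ofReal_le_ofReal (by nlinarith [sq_nonneg (g x - f x)])

section Partition

theorem exists_mem_Icc_castSucc_succ {α : Type*} [LinearOrder α] {N : ℕ} (hN : 0 < N)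
    {t : Fin (N + 1) → α} {x : α} (hx : x ∈ Icc (t 0) (t (Fin.last N))) :
    ∃ j : Fin N, x ∈ Icc (t j.castSucc) (t j.succ) := by
  induction N, hN using Nat.le_induction with
  | base => exact ⟨0, hx⟩
  | succ N _ ih =>
    rcases le_total x (t (Fin.last N).castSucc) with h | h
    · obtain ⟨j, hj⟩ := ih (t := fun l => t l.castSucc) ⟨hx.1, h⟩
      exact ⟨j.castSucc, hj⟩
    · exact ⟨Fin.last N, h, hx.2⟩

theorem pairwise_disjoint_Ioo_castSucc_succ {α : Type*} [Preorder α] {N : ℕ}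
    {t : Fin (N + 1) → α} (ht : Monotone t) :
    Pairwise (Function.onFun Disjoint fun j : Fin N => Ioo (t j.castSucc) (t j.succ)) :=
  fun j j' hne => by
    simpa only [Function.onFun, Fin.orderSucc_castSucc] using
      ht.pairwise_disjoint_on_Ioo_succ ((Fin.castSucc_injective N).ne hne)

theorem exists_eq_add_of_mem_Icc_castSucc_succ {α : Type*} [Preorder α] {N : ℕ}
    {t : Fin (N + 1) → α} (ht : StrictMono t) {j : Fin N} {l : Fin (N + 1)}
    (hl : t l ∈ Icc (t j.castSucc) (t j.succ)) : ∃ r : Fin 2, (l : ℕ) = j + r := by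
  have lower : (j : ℕ) ≤ l := ht.le_iff_le.1 hl.1
  have upper : (l : ℕ) ≤ j + 1 := ht.le_iff_le.1 hl.2
  exact ⟨⟨l - j, by omega⟩, by simp only; omega⟩

theorem hasDerivWithinAt_iUnion_of_isClosed {𝕜 F ι : Type*} [NontriviallyNormedField 𝕜]
    [NormedAddCommGroup F] [NormedSpace 𝕜 F] [Finite ι] {f : 𝕜 → F} {f' : F} {x : 𝕜}
    {s : ι → Set 𝕜} (hs : ∀ i, IsClosed (s i))
    (h : ∀ i, x ∈ s i → HasDerivWithinAt f f' (s i) x) :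
    HasDerivWithinAt f f' (⋃ i, s i) x := by
  have pieces : ∀ i, HasDerivWithinAt f f' (s i) x := fun i => by
    by_cases hx : x ∈ s i
    · exact h i hx
    · exact HasFDerivWithinAt.of_notMem_closure (by rwa [(hs i).closure_eq])
  simp only [hasDerivWithinAt_iff_tendsto_slope, iUnion_sdiff, nhdsWithin_iUnion, tendsto_iSup]
    at pieces ⊢
  exact pieces

end Partition

section HermiteSpline

open Polynomial (C X derivative)

theorem iterate_derivative_comp_C_mul_X_sub_C {R : Type*} [CommRing R] (f : R[X]) (s t : R)
    (b : ℕ) :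
    derivative^[b] (f.comp (C s * (X - C t))) =
      C (s ^ b) * (derivative^[b] f).comp (C s * (X - C t)) := by
  induction b with
  | zero => simp
  | succ b ih =>
    rw [Function.iterate_succ_apply', ih, Function.iterate_succ_apply',
      Polynomial.derivative_C_mul, Polynomial.derivative_comp, Polynomial.derivative_C_mul,
      Polynomial.derivative_X_sub_C, pow_succ, Polynomial.C_mul]
    ring

/-- The Hermite basis polynomial `RectGrid.hermiteBasis k a q`, transplanted from `[0, 1]` to
`[s, t]`. The factor `(t - s) ^ a` compensates the chain rule, so that the derivative of order `a`
at the end point `![s, t] q` is `1` again. -/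
noncomputable def rescaledHermite (k a : ℕ) (q : Fin 2) (s t : ℝ) : ℝ[X] :=
  C ((t - s) ^ a) * (RectGrid.hermiteBasis k a q).comp (C (t - s)⁻¹ * (X - C s))

theorem rescaledHermite_eval (k a : ℕ) (q : Fin 2) (s t x : ℝ) :
    (rescaledHermite k a q s t).eval x =
      (t - s) ^ a * (RectGrid.hermiteBasis k a q).eval ((x - s) / (t - s)) := by
  simp only [rescaledHermite, Polynomial.eval_mul, Polynomial.eval_C, Polynomial.eval_comp,
    Polynomial.eval_sub, Polynomial.eval_X, div_eq_inv_mul]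

theorem rescaledHermite_natDegree_le {k a : ℕ} (ha : a ≤ k) (q : Fin 2) (s t : ℝ) :
    (rescaledHermite k a q s t).natDegree ≤ 2 * k + 1 := calc
  _ ≤ ((RectGrid.hermiteBasis k a q).comp (C (t - s)⁻¹ * (X - C s))).natDegree :=
    Polynomial.natDegree_C_mul_le _ _
  _ ≤ (2 * k + 1) * 1 := Polynomial.natDegree_comp_le.trans <|
    Nat.mul_le_mul (RectGrid.hermiteBasis_natDegree_le k a q ha) <|
      (Polynomial.natDegree_C_mul_le _ _).trans (Polynomial.natDegree_X_sub_C_le _)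
  _ = 2 * k + 1 := mul_one _

theorem iterate_derivative_rescaledHermite_eval {k a b : ℕ} (ha : a ≤ k) (hb : b ≤ k)
    (q r : Fin 2) {s t : ℝ} (hst : s ≠ t) :
    (derivative^[b] (rescaledHermite k a q s t)).eval (![s, t] r) =
      if a = b ∧ q = r then 1 else 0 := by
  have hΔ : t - s ≠ 0 := sub_ne_zero.2 hst.symm
  have endpoint : (t - s)⁻¹ * (![s, t] r - s) = ((r : ℕ) : ℝ) := by
    fin_cases r <;> simp [hΔ]
  rw [rescaledHermite, Polynomial.iterate_derivative_C_mul, iterate_derivative_comp_C_mul_X_sub_C]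
  simp only [Polynomial.eval_mul, Polynomial.eval_C, Polynomial.eval_comp, Polynomial.eval_sub,
    Polynomial.eval_X, endpoint, RectGrid.hermiteBasis_eval k a b q r ha hb]
  split_ifs with h
  · rw [h.1, mul_one, ← mul_pow, mul_inv_cancel₀ hΔ, one_pow]
  · simp only [mul_zero]

variable {k a b N : ℕ} {t : Fin (N + 1) → ℝ}

/-- The restriction to the subinterval `[t j, t (j + 1)]` of the Hermite spline of order `a` at the
node `t m`. It is `0` unless `t m` is an end point of this subinterval. -/
noncomputable def hermitePiece (k : ℕ) (t : Fin (N + 1) → ℝ) (m : Fin (N + 1)) (a : ℕ)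
    (j : Fin N) : ℝ[X] :=
  ∑ q : Fin 2, if (m : ℕ) = j + q then rescaledHermite k a q (t j.castSucc) (t j.succ) else 0

theorem hermitePiece_natDegree_le (ha : a ≤ k) (m : Fin (N + 1)) (j : Fin N) :
    (hermitePiece k t m a j).natDegree ≤ 2 * k + 1 := by
  refine Polynomial.natDegree_sum_le_of_forall_le _ _ fun q _ => ?_
  split_ifs
  · exact rescaledHermite_natDegree_le ha q _ _
  · simp

theorem iterate_derivative_hermitePiece_eval_node (ht : StrictMono t) (ha : a ≤ k) (hb : b ≤ k)
    (m : Fin (N + 1)) {l : Fin (N + 1)} {j : Fin N}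
    (hl : t l ∈ Icc (t j.castSucc) (t j.succ)) :
    (derivative^[b] (hermitePiece k t m a j)).eval (t l) = if m = l ∧ a = b then 1 else 0 := by
  obtain ⟨r, hr⟩ := exists_eq_add_of_mem_Icc_castSucc_succ ht hl
  have node_eq : t l = ![t j.castSucc, t j.succ] r := by
    obtain rfl : l = ![j.castSucc, j.succ] r := Fin.ext (by fin_cases r <;> simpa using hr)
    fin_cases r <;> rfl
  have summand : ∀ q : Fin 2, (derivative^[b] (if (m : ℕ) = j + q then
      rescaledHermite k a q (t j.castSucc) (t j.succ) else 0)).eval (t l) =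
        if q = r then if m = l ∧ a = b then 1 else 0 else 0 := by
    intro q
    rw [apply_ite derivative^[b], Polynomial.iterate_derivative_zero, apply_ite (Polynomial.eval _),
      Polynomial.eval_zero, node_eq,
      iterate_derivative_rescaledHermite_eval ha hb q r (ht Fin.castSucc_lt_succ).ne]
    simp only [Fin.ext_iff, hr, ← ite_and]
    exact if_congr (by omega) rfl rfl
  rw [hermitePiece, Polynomial.iterate_derivative_sum, Polynomial.eval_finsetSum,
    Finset.sum_congr rfl fun q _ => summand q, Finset.sum_ite_eq' Finset.univ r,
    if_pos (Finset.mem_univ r)]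

theorem iterate_derivative_hermitePiece_eval_eq (ht : StrictMono t) (ha : a ≤ k) (hb : b ≤ k)
    (m : Fin (N + 1)) {x : ℝ} {j j' : Fin N} (hj : x ∈ Icc (t j.castSucc) (t j.succ))
    (hj' : x ∈ Icc (t j'.castSucc) (t j'.succ)) :
    (derivative^[b] (hermitePiece k t m a j)).eval x =
      (derivative^[b] (hermitePiece k t m a j')).eval x := by
  wlog hlt : j < j' generalizing j j'
  · rcases (not_lt.1 hlt).eq_or_lt with rfl | h
    exacts [rfl, (this hj' hj h).symm]
  have x_eq : x = t j.succ :=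
    hj.2.antisymm ((ht.monotone (Fin.succ_le_castSucc_iff.2 hlt)).trans hj'.1)
  subst x_eq
  rw [iterate_derivative_hermitePiece_eval_node ht ha hb m hj,
    iterate_derivative_hermitePiece_eval_node ht ha hb m hj']

open Classical in
/-- The derivative of order `b` of the Hermite spline of order `a` at the node `t m`: on
`[t 0, t N]`, the piecewise polynomial function whose derivatives of order `≤ k` vanish at all
nodes, except for the derivative of order `a` at `t m`, which is `1`. For `b ≤ k` the choice of the
subinterval is irrelevant, see `hermiteSpline_eq`. -/
noncomputable def hermiteSpline (k : ℕ) (t : Fin (N + 1) → ℝ) (m : Fin (N + 1)) (a b : ℕ)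
    (x : ℝ) : ℝ :=
  if h : ∃ j : Fin N, x ∈ Icc (t j.castSucc) (t j.succ) then
    (derivative^[b] (hermitePiece k t m a h.choose)).eval x else 0

theorem hermiteSpline_eq (ht : StrictMono t) (ha : a ≤ k) (hb : b ≤ k) (m : Fin (N + 1)) {x : ℝ}
    {j : Fin N} (hj : x ∈ Icc (t j.castSucc) (t j.succ)) :
    hermiteSpline k t m a b x = (derivative^[b] (hermitePiece k t m a j)).eval x := by
  have h : ∃ j : Fin N, x ∈ Icc (t j.castSucc) (t j.succ) := ⟨j, hj⟩
  rw [hermiteSpline, dif_pos h]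
  exact iterate_derivative_hermitePiece_eval_eq ht ha hb m h.choose_spec hj

theorem hermiteSpline_node (hN : 0 < N) (ht : StrictMono t) (ha : a ≤ k) (hb : b ≤ k)
    (m l : Fin (N + 1)) :
    hermiteSpline k t m a b (t l) = if m = l ∧ a = b then 1 else 0 := by
  obtain ⟨j, hj⟩ := exists_mem_Icc_castSucc_succ hN (t := t) (x := t l)
    ⟨ht.monotone (Fin.zero_le _), ht.monotone (Fin.le_last _)⟩
  rw [hermiteSpline_eq ht ha hb m hj, iterate_derivative_hermitePiece_eval_node ht ha hb m hj]

theorem hasDerivWithinAt_hermiteSpline (hN : 0 < N) (ht : StrictMono t) (ha : a ≤ k) (hb : b < k)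
    (m : Fin (N + 1)) (x : ℝ) :
    HasDerivWithinAt (hermiteSpline k t m a b) (hermiteSpline k t m a (b + 1) x)
      (Icc (t 0) (t (Fin.last N))) x := by
  refine (hasDerivWithinAt_iUnion_of_isClosed (s := fun j : Fin N => Icc (t j.castSucc) (t j.succ))
    (fun j => isClosed_Icc) fun j hj => ?_).mono
    fun y hy => mem_iUnion.2 (exists_mem_Icc_castSucc_succ hN hy)
  rw [hermiteSpline_eq ht ha hb m hj, Function.iterate_succ_apply']
  exact (Polynomial.hasDerivAt _ x).hasDerivWithinAt.congr
    (fun y hy => hermiteSpline_eq ht ha hb.le m hy) (hermiteSpline_eq ht ha hb.le m hj)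

end HermiteSpline

section MixedDerivatives

/-- The list in which every index `i` occurs `γ i` times, so that `∂^γ` is the composition of the
`∂_i` along it. -/
def multiIndexList {p : ℕ} (γ : Fin p → ℕ) : List (Fin p) :=
  (List.finRange p).flatMap fun i => List.replicate (γ i) i

theorem count_multiIndexList {p : ℕ} (γ : Fin p → ℕ) (i : Fin p) :
    (multiIndexList γ).count i = γ i := by
  simp only [multiIndexList, List.count_flatMap, Function.comp_def, List.count_replicate,
    beq_iff_eq]
  rw [← List.ofFn_eq_map, List.sum_ofFn, Finset.sum_ite_eq' Finset.univ i,
    if_pos (Finset.mem_univ i)]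

theorem length_multiIndexList {p : ℕ} (γ : Fin p → ℕ) :
    (multiIndexList γ).length = ∑ i, γ i := by
  simp only [multiIndexList, List.length_flatMap, List.length_replicate]
  rw [← List.ofFn_eq_map, List.sum_ofFn]

theorem cons_multiIndexList_perm {p : ℕ} (γ : Fin p → ℕ) (i : Fin p) :
    (i :: multiIndexList γ).Perm (multiIndexList (Function.update γ i (γ i + 1))) := by
  refine List.perm_iff_count.2 fun j => ?_
  rw [List.count_cons, count_multiIndexList, count_multiIndexList]
  rcases eq_or_ne j i with rfl | hj
  · simp
  · simp [hj, hj.symm]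

theorem foldr_replicate {α β : Type*} (f : α → β → β) (b : β) (n : ℕ) (a : α) :
    (List.replicate n a).foldr f b = (f a)^[n] b := by
  induction n with
  | zero => rfl
  | succ n ih => rw [List.replicate_succ, List.foldr_cons, ih, Function.iterate_succ_apply']

theorem hasDerivAt_comp_update {p : ℕ} {E : Type*} [NormedAddCommGroup E] [NormedSpace ℝ E]
    {f : (Fin p → ℝ) → E} {x : Fin p → ℝ} (h : DifferentiableAt ℝ f x) (i : Fin p) :
    HasDerivAt (fun s => f (Function.update x i s)) (fderiv ℝ f x (Pi.single i 1)) (x i) := by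
  have hd : HasFDerivAt f (fderiv ℝ f x) (Function.update x i (x i)) := by
    rw [Function.update_eq_self]; exact h.hasFDerivAt
  exact hd.comp_hasDerivAt (x i) (hasDerivAt_update x i (x i))

namespace RectGrid

variable {p : ℕ} (G : RectGrid p)

theorem mixedDeriv_eq_foldr (γ : Fin p → ℕ) (f : (Fin p → ℝ) → ℝ) :
    G.mixedDeriv γ f = (multiIndexList γ).foldr G.pderiv f := by
  rw [multiIndexList, List.foldr_flatMap, mixedDeriv]
  simp only [foldr_replicate]

theorem mixedDeriv_zero (f : (Fin p → ℝ) → ℝ) : G.mixedDeriv 0 f = f :=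
  List.foldr_fixed' (fun _ => rfl) _

theorem lo_lt_hi (i : Fin p) : G.lo i < G.hi i :=
  G.node_strictMono i (Fin.lt_def.2 (G.numCells_pos i))

theorem update_mem_domain {x : Fin p → ℝ} (hx : x ∈ G.domain) {i : Fin p} {t : ℝ}
    (ht : t ∈ Icc (G.lo i) (G.hi i)) : Function.update x i t ∈ G.domain :=
  (update_mem_pi_iff_of_mem hx).2 fun _ => ht

theorem eventually_update_mem {s : Set (Fin p → ℝ)} {x : Fin p → ℝ} (hx : x ∈ G.domain)
    (hs : s ∈ 𝓝[G.domain] x) (i : Fin p) :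
    ∀ᶠ t in 𝓝[Icc (G.lo i) (G.hi i)] x i, Function.update x i t ∈ s := by
  have tendsto_update : Tendsto (Function.update x i) (𝓝[Icc (G.lo i) (G.hi i)] x i)
      (𝓝[G.domain] x) := by
    refine tendsto_nhdsWithin_iff.2 ⟨?_, ?_⟩
    · exact ((continuous_const.update i continuous_id).tendsto' _ _
        (Function.update_eq_self i x)).mono_left nhdsWithin_le_nhds
    · filter_upwards [self_mem_nhdsWithin] with t ht using G.update_mem_domain hx ht
  exact tendsto_update hs

theorem pderiv_eq_of_eqOn {f h : (Fin p → ℝ) → ℝ} {s : Set (Fin p → ℝ)} {x : Fin p → ℝ} {f' : ℝ}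
    (hfh : EqOn f h s) (hsΩ : s ⊆ G.domain) (hs : s ∈ 𝓝[G.domain] x) (hx : x ∈ s) {i : Fin p}
    (hh : HasDerivWithinAt (fun t => h (Function.update x i t)) f' (Icc (G.lo i) (G.hi i)) (x i)) :
    G.pderiv i f x = f' := by
  refine (hh.congr_of_eventuallyEq ?_ ?_).derivWithin
    (uniqueDiffOn_Icc (G.lo_lt_hi i) _ (hsΩ hx i trivial))
  · filter_upwards [G.eventually_update_mem (hsΩ hx) hs i] with t ht using hfh ht
  · rw [Function.update_eq_self, hfh hx]

theorem eqOn_mixedDeriv_of_hasDerivWithinAt {β : Fin p → ℕ} {f : (Fin p → ℝ) → ℝ}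
    {g : (Fin p → ℕ) → (Fin p → ℝ) → ℝ} {s : Set (Fin p → ℝ)} (hsΩ : s ⊆ G.domain)
    (hs : ∀ x ∈ s, s ∈ 𝓝[G.domain] x) (hf : EqOn f (g 0) s)
    (hg : ∀ γ ≤ β, ∀ i, γ i < β i → ∀ x ∈ s, HasDerivWithinAt
      (fun t => g γ (Function.update x i t)) (g (Function.update γ i (γ i + 1)) x)
      (Icc (G.lo i) (G.hi i)) (x i)) :
    EqOn (G.mixedDeriv β f) (g β) s := by
  suffices along_list : ∀ L : List (Fin p), (∀ j, L.count j ≤ β j) →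
      EqOn (L.foldr G.pderiv f) (g fun j => L.count j) s by
    have h := along_list (multiIndexList β) fun j => (count_multiIndexList β j).le
    simpa only [← G.mixedDeriv_eq_foldr, count_multiIndexList] using h
  intro L hL
  induction L with
  | nil => exact hf
  | cons i L ih =>
    have hle : ∀ j, L.count j ≤ β j := fun j => List.count_le_count_cons.trans (hL j)
    have hlt : L.count i < β i := by simpa only [List.count_cons_self, Nat.succ_le_iff] using hL i
    have count_cons : (fun j => (i :: L).count j) =
        Function.update (fun j => L.count j) i (L.count i + 1) := by
      funext j
      rcases eq_or_ne j i with rfl | hj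
      · simp
      · simp [hj, hj.symm]
    intro x hx
    rw [count_cons, List.foldr_cons]
    exact G.pderiv_eq_of_eqOn (ih hle) hsΩ (hs x hx) hx (hg _ hle i hlt x hx)

section OpenSubset

variable {G} {U : Set (Fin p → ℝ)} {f g : (Fin p → ℝ) → ℝ}

theorem eqOn_mixedDeriv_of_isMixedDerivSystem {β : Fin p → ℕ}
    {g : (Fin p → ℕ) → (Fin p → ℝ) → ℝ} (hg : IsMixedDerivSystem β g U) (hU : IsOpen U)
    (hUΩ : U ⊆ G.domain) (hf : EqOn f (g 0) U) : EqOn (G.mixedDeriv β f) (g β) U :=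
  G.eqOn_mixedDeriv_of_hasDerivWithinAt hUΩ
    (fun _ hx => mem_nhdsWithin_of_mem_nhds (hU.mem_nhds hx)) hf
    fun γ hγ i hi x hx => (hg.hasDerivAt γ hγ i hi x hx).hasDerivWithinAt

theorem eqOn_pderiv_fderiv (hU : IsOpen U) (hUΩ : U ⊆ G.domain) (hfg : EqOn f g U)
    (hg : DifferentiableOn ℝ g U) (i : Fin p) :
    EqOn (G.pderiv i f) (fun x => fderiv ℝ g x (Pi.single i 1)) U := fun _ hx =>
  G.pderiv_eq_of_eqOn hfg hUΩ (mem_nhdsWithin_of_mem_nhds (hU.mem_nhds hx)) hx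
    (hasDerivAt_comp_update (hg.differentiableAt (hU.mem_nhds hx)) i).hasDerivWithinAt

theorem eqOn_pderiv (hU : IsOpen U) (hfg : EqOn f g U) (i : Fin p) :
    EqOn (G.pderiv i f) (G.pderiv i g) U := fun x hx => by
  have tendsto_update : Tendsto (Function.update x i) (𝓝 (x i)) (𝓝 x) :=
    (continuous_const.update i continuous_id).tendsto' _ _ (Function.update_eq_self i x)
  refine EventuallyEq.derivWithin_eq ?_ (by simpa only [Function.update_eq_self] using hfg hx)
  exact nhdsWithin_le_nhds (tendsto_update (mem_of_superset (hU.mem_nhds hx) hfg))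

theorem contDiffOn_pderiv_of_isOpen (hU : IsOpen U) (hUΩ : U ⊆ G.domain) {n : ℕ}
    (hf : ContDiffOn ℝ ((n + 1 : ℕ) : WithTop ℕ∞) f U) (i : Fin p) :
    ContDiffOn ℝ (n : WithTop ℕ∞) (G.pderiv i f) U :=
  ((hf.fderiv_of_isOpen hU (m := (n : WithTop ℕ∞)) (by exact_mod_cast le_rfl)).clm_apply
    contDiffOn_const).congr <| eqOn_pderiv_fderiv hU hUΩ (fun _ _ => rfl)
      (hf.differentiableOn (by exact_mod_cast n.succ_ne_zero)) i

theorem contDiffOn_foldr_pderiv (hU : IsOpen U) (hUΩ : U ⊆ G.domain) (L : List (Fin p)) {n : ℕ}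
    (hf : ContDiffOn ℝ ((n + L.length : ℕ) : WithTop ℕ∞) f U) :
    ContDiffOn ℝ (n : WithTop ℕ∞) (L.foldr G.pderiv f) U := by
  induction L generalizing n with
  | nil => exact hf
  | cons i L ih =>
    refine contDiffOn_pderiv_of_isOpen hU hUΩ (ih ?_) i
    rwa [add_assoc, add_comm 1, ← List.length_cons (a := i)]

theorem eqOn_pderiv_pderiv_fderiv_fderiv (hU : IsOpen U) (hUΩ : U ⊆ G.domain)
    (hf : ContDiffOn ℝ 2 f U) (i j : Fin p) :
    EqOn (G.pderiv i (G.pderiv j f))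
      (fun x => fderiv ℝ (fderiv ℝ f) x (Pi.single i 1) (Pi.single j 1)) U := by
  have hf' : DifferentiableOn ℝ (fderiv ℝ f) U :=
    (hf.fderiv_of_isOpen hU (m := 1) (by norm_num)).differentiableOn one_ne_zero
  intro x hx
  rw [eqOn_pderiv_fderiv hU hUΩ
    (eqOn_pderiv_fderiv hU hUΩ (fun _ _ => rfl) (hf.differentiableOn two_ne_zero) j)
    (hf'.clm_apply (differentiableOn_const _)) i hx]
  beta_reduce
  rw [fderiv_clm_apply (hf'.differentiableAt (hU.mem_nhds hx)) (differentiableAt_const _)]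
  simp

theorem eqOn_pderiv_comm (hU : IsOpen U) (hUΩ : U ⊆ G.domain) (hf : ContDiffOn ℝ 2 f U)
    (i j : Fin p) : EqOn (G.pderiv i (G.pderiv j f)) (G.pderiv j (G.pderiv i f)) U := by
  intro x hx
  rw [eqOn_pderiv_pderiv_fderiv_fderiv hU hUΩ hf i j hx,
    eqOn_pderiv_pderiv_fderiv_fderiv hU hUΩ hf j i hx]
  exact ((hf.contDiffAt (hU.mem_nhds hx)).isSymmSndFDerivAt (by simp)).eq _ _

theorem eqOn_foldr_pderiv_of_perm (hU : IsOpen U) (hUΩ : U ⊆ G.domain) {L L' : List (Fin p)}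
    (h : L.Perm L') (hf : ContDiffOn ℝ (L.length : WithTop ℕ∞) f U) :
    EqOn (L.foldr G.pderiv f) (L'.foldr G.pderiv f) U := by
  induction h with
  | nil => exact fun _ _ => rfl
  | cons i _ ih =>
    exact eqOn_pderiv hU (ih (hf.of_le (by exact_mod_cast Nat.le_succ _))) i
  | swap i j L =>
    refine eqOn_pderiv_comm hU hUΩ ?_ j i
    refine contDiffOn_foldr_pderiv (n := 2) hU hUΩ L ?_
    rwa [add_comm]
  | trans h₁ _ ih₁ ih₂ => exact (ih₁ hf).trans (ih₂ (h₁.length_eq ▸ hf))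

theorem contDiffOn_mixedDeriv (hU : IsOpen U) (hUΩ : U ⊆ G.domain) {γ : Fin p → ℕ} {n : ℕ}
    (hf : ContDiffOn ℝ ((n + ∑ i, γ i : ℕ) : WithTop ℕ∞) f U) :
    ContDiffOn ℝ (n : WithTop ℕ∞) (G.mixedDeriv γ f) U := by
  rw [mixedDeriv_eq_foldr]
  exact contDiffOn_foldr_pderiv hU hUΩ _ (by rwa [length_multiIndexList])

theorem eqOn_pderiv_mixedDeriv (hU : IsOpen U) (hUΩ : U ⊆ G.domain) {γ : Fin p → ℕ} (i : Fin p)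
    (hf : ContDiffOn ℝ ((1 + ∑ i, γ i : ℕ) : WithTop ℕ∞) f U) :
    EqOn (G.pderiv i (G.mixedDeriv γ f)) (G.mixedDeriv (Function.update γ i (γ i + 1)) f) U := by
  rw [mixedDeriv_eq_foldr, mixedDeriv_eq_foldr]
  refine eqOn_foldr_pderiv_of_perm hU hUΩ (cons_multiIndexList_perm γ i) ?_
  rwa [List.length_cons, length_multiIndexList, add_comm]

theorem isMixedDerivSystem_mixedDeriv (hU : IsOpen U) (hUΩ : U ⊆ G.domain) {β : Fin p → ℕ}
    (hf : ContDiffOn ℝ ((∑ i, β i : ℕ) : WithTop ℕ∞) f U) :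
    IsMixedDerivSystem β (fun γ => G.mixedDeriv γ f) U where
  continuousOn γ hγ := by
    refine (contDiffOn_mixedDeriv (n := 0) hU hUΩ (hf.of_le ?_)).continuousOn
    rw [zero_add]
    exact_mod_cast Finset.sum_le_sum fun i _ => hγ i
  hasDerivAt γ hγ i hi x hx := by
    have order_lt : 1 + ∑ j, γ j ≤ ∑ j, β j := by
      rw [add_comm]
      exact Finset.sum_lt_sum (fun j _ => hγ j) ⟨i, Finset.mem_univ i, hi⟩
    have hf' : ContDiffOn ℝ ((1 + ∑ j, γ j : ℕ) : WithTop ℕ∞) f U :=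
      hf.of_le (by exact_mod_cast order_lt)
    have hd : DifferentiableOn ℝ (G.mixedDeriv γ f) U :=
      (contDiffOn_mixedDeriv hU hUΩ hf').differentiableOn (by norm_num)
    rw [← eqOn_pderiv_mixedDeriv hU hUΩ i hf' hx,
      eqOn_pderiv_fderiv hU hUΩ (fun _ _ => rfl) hd i hx]
    exact hasDerivAt_comp_update (hd.differentiableAt (hU.mem_nhds hx)) i

theorem eqOn_mixedDeriv_sub (hU : IsOpen U) (hUΩ : U ⊆ G.domain) {β : Fin p → ℕ}
    (hf : ContDiffOn ℝ ((∑ i, β i : ℕ) : WithTop ℕ∞) f U)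
    (hg : ContDiffOn ℝ ((∑ i, β i : ℕ) : WithTop ℕ∞) g U) :
    EqOn (G.mixedDeriv β fun x => f x - g x) (G.mixedDeriv β f - G.mixedDeriv β g) U :=
  eqOn_mixedDeriv_of_isMixedDerivSystem ((isMixedDerivSystem_mixedDeriv hU hUΩ hf).sub
    (isMixedDerivSystem_mixedDeriv hU hUΩ hg)) hU hUΩ fun _ _ => by
      simp only [Pi.sub_apply, mixedDeriv_zero]

end OpenSubset

end RectGrid

end MixedDerivatives

section TensorSum

variable {p : ℕ} {ι : Type*} [Fintype ι]

/-- The mixed derivative of order `γ` of the sum of the tensor products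
`x ↦ ∏ i, U l i 0 (x i)` with coefficients `d l`, when `U l i b` is the derivative of order `b` of
`U l i 0`. -/
noncomputable def tensorSum (d : ι → ℝ) (U : ι → Fin p → ℕ → ℝ → ℝ) (γ : Fin p → ℕ)
    (x : Fin p → ℝ) : ℝ :=
  ∑ l, d l * ∏ i, U l i (γ i) (x i)

theorem hasDerivWithinAt_tensorSum (d : ι → ℝ) {U : ι → Fin p → ℕ → ℝ → ℝ} {γ : Fin p → ℕ}
    {x : Fin p → ℝ} {i : Fin p} {s : Set ℝ}
    (hU : ∀ l, HasDerivWithinAt (U l i (γ i)) (U l i (γ i + 1) (x i)) s (x i)) :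
    HasDerivWithinAt (fun t => tensorSum d U γ (Function.update x i t))
      (tensorSum d U (Function.update γ i (γ i + 1)) x) s (x i) := by
  refine HasDerivWithinAt.fun_sum fun l _ => HasDerivWithinAt.const_mul _ ?_
  simp only [Function.apply_update fun j => U l j (γ j),
    Function.apply_update fun j n => U l j n (x j), Finset.prod_update_of_mem (Finset.mem_univ i)]
  exact (hU l).mul_const _

end TensorSum

namespace RectGrid

variable {p k : ℕ} (G : RectGrid p)

section Cells

theorem mem_closedCell_iff {c : G.Cell} {x : Fin p → ℝ} : x ∈ G.closedCell c ↔
    ∀ i, x i ∈ Icc (G.node i (c i).castSucc) (G.node i (c i).succ) :=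
  mem_univ_pi

theorem exists_mem_closedCell {x : Fin p → ℝ} (hx : x ∈ G.domain) :
    ∃ c : G.Cell, x ∈ G.closedCell c := by
  choose c hc using fun i => exists_mem_Icc_castSucc_succ (G.numCells_pos i) (hx i trivial)
  exact ⟨c, G.mem_closedCell_iff.2 hc⟩

theorem closedCell_subset_domain (c : G.Cell) : G.closedCell c ⊆ G.domain :=
  pi_mono fun i _ => Icc_subset_Icc ((G.node_strictMono i).monotone (Fin.zero_le _))
    ((G.node_strictMono i).monotone (Fin.le_last _))

theorem openCell_subset_closedCell (c : G.Cell) : G.openCell c ⊆ G.closedCell c :=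
  pi_mono fun _ _ => Ioo_subset_Icc_self

theorem openCell_subset_domain (c : G.Cell) : G.openCell c ⊆ G.domain :=
  (G.openCell_subset_closedCell c).trans (G.closedCell_subset_domain c)

theorem isOpen_openCell (c : G.Cell) : IsOpen (G.openCell c) :=
  isOpen_set_pi finite_univ fun _ _ => isOpen_Ioo

theorem cellLo_lt_cellHi (c : G.Cell) (i : Fin p) : G.cellLo c i < G.cellHi c i :=
  G.node_strictMono i Fin.castSucc_lt_succ

theorem point_vertex (c : G.Cell) (q : Fin p → Fin 2) :
    G.point (G.vertex c q) = corner (G.cellLo c) (G.cellHi c) q := by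
  funext i
  have coordinate : ∀ (r : Fin 2) (h : (c i : ℕ) + r < G.numCells i + 1),
      G.node i ⟨c i + r, h⟩ = ![G.cellLo c i, G.cellHi c i] r := by
    intro r h
    fin_cases r <;> rfl
  exact coordinate (q i) _

theorem point_vertex_mem_closedCell (c : G.Cell) (q : Fin p → Fin 2) :
    G.point (G.vertex c q) ∈ G.closedCell c := by
  rw [point_vertex]
  exact fun i _ => cons_val_mem_Icc (G.cellLo_lt_cellHi c i).le (q i)

theorem point_mem_domain (m : G.Index) : G.point m ∈ G.domain := fun i _ =>
  ⟨(G.node_strictMono i).monotone (Fin.zero_le _), (G.node_strictMono i).monotone (Fin.le_last _)⟩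

end Cells

section Interpolant

/-- The mixed derivative of order `γ` of the polynomial that the interpolant is in the cell `c`. -/
noncomputable def cellDeriv (d : G.Data k) (c : G.Cell) : (Fin p → ℕ) → (Fin p → ℝ) → ℝ :=
  tensorSum (fun l : G.Index × (Fin p → Fin (k + 1)) => d l.1 l.2) fun l i b t =>
    (Polynomial.derivative^[b] (hermitePiece k (G.node i) (l.1 i) (l.2 i) (c i))).eval t

/-- The mixed derivative of order `γ` of the interpolant on all of `Ω`, for `γ ∈ {0,…,k}^p`. -/
noncomputable def splineDeriv (d : G.Data k) : (Fin p → ℕ) → (Fin p → ℝ) → ℝ :=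
  tensorSum (fun l : G.Index × (Fin p → Fin (k + 1)) => d l.1 l.2) fun l i =>
    hermiteSpline k (G.node i) (l.1 i) (l.2 i)

theorem prod_hermitePiece_eval (c : G.Cell) (m : G.Index) (α : Fin p → Fin (k + 1))
    (x : Fin p → ℝ) : ∏ i, (hermitePiece k (G.node i) (m i) (α i) (c i)).eval (x i) =
      ∑ q : Fin p → Fin 2, if m = G.vertex c q then
        ∏ i, (rescaledHermite k (α i) (q i) (G.cellLo c i) (G.cellHi c i)).eval (x i) else 0 := by
  simp only [hermitePiece, Polynomial.eval_finsetSum, Finset.prod_univ_sum, Fintype.piFinset_univ,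
    apply_ite (Polynomial.eval _), Polynomial.eval_zero, Finset.prod_ite_zero]
  have vertex_iff : ∀ q, m = G.vertex c q ↔ ∀ i, (m i : ℕ) = c i + q i := fun q => by
    simp only [funext_iff, Fin.ext_iff, vertex]
  simp only [vertex_iff, Finset.mem_univ, true_imp_iff, cellLo, cellHi]

theorem cellInterpolant_eq_cellDeriv (d : G.Data k) (c : G.Cell) :
    G.cellInterpolant k d c = G.cellDeriv d c 0 := by
  funext x
  simp only [cellInterpolant, cellDeriv, tensorSum, Pi.zero_apply, Function.iterate_zero_apply,
    prod_hermitePiece_eval, Fintype.sum_prod_type_right, Finset.mul_sum, mul_ite, mul_zero]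
  rw [Finset.sum_comm]
  refine Finset.sum_congr rfl fun α _ => ?_
  rw [Finset.sum_comm]
  simp only [Finset.sum_ite_eq', Finset.mem_univ, if_true, rescaledHermite_eval]

theorem splineDeriv_eq_cellDeriv (d : G.Data k) {c : G.Cell} {γ : Fin p → ℕ} (hγ : ∀ i, γ i ≤ k)
    {x : Fin p → ℝ} (hx : x ∈ G.closedCell c) : G.splineDeriv d γ x = G.cellDeriv d c γ x := by
  refine Finset.sum_congr rfl fun l _ => congrArg _ (Finset.prod_congr rfl fun i _ => ?_)
  exact hermiteSpline_eq (G.node_strictMono i) (l.2 i).is_le (hγ i) (l.1 i)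
    (G.mem_closedCell_iff.1 hx i)

theorem splineDeriv_point (d : G.Data k) (m : G.Index) (α : Fin p → Fin (k + 1)) :
    G.splineDeriv d (fun i => α i) (G.point m) = d m α := by
  have spline_node : ∀ l : G.Index × (Fin p → Fin (k + 1)),
      ∏ i, hermiteSpline k (G.node i) (l.1 i) (l.2 i) (α i) (G.point m i) =
        if l = (m, α) then 1 else 0 := by
    intro l
    simp only [point, hermiteSpline_node (G.numCells_pos _) (G.node_strictMono _) (l.2 _).is_le
      (α _).is_le, Finset.prod_ite_zero, Finset.prod_const_one]
    refine if_congr ?_ rfl rfl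
    simp only [Prod.ext_iff, funext_iff, Finset.mem_univ, true_imp_iff, forall_and, Fin.val_inj]
  simp only [splineDeriv, tensorSum, spline_node, mul_ite, mul_one, mul_zero,
    Finset.sum_ite_eq', Finset.mem_univ, if_true]

theorem cellDeriv_point_vertex (d : G.Data k) (c : G.Cell) (q : Fin p → Fin 2)
    (α : Fin p → Fin (k + 1)) :
    G.cellDeriv d c (fun i => α i) (G.point (G.vertex c q)) = d (G.vertex c q) α := by
  rw [← G.splineDeriv_eq_cellDeriv d (fun i => (α i).is_le) (G.point_vertex_mem_closedCell c q),
    splineDeriv_point]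

theorem contDiff_cellDeriv (d : G.Data k) (c : G.Cell) (γ : Fin p → ℕ) (n : WithTop ℕ∞) :
    ContDiff ℝ n (G.cellDeriv d c γ) :=
  ContDiff.sum fun _ _ => contDiff_const.mul <| contDiff_prod fun i _ =>
    (show ContDiff ℝ n fun t : ℝ => Polynomial.eval t _ from Polynomial.contDiff_aeval _ n).comp
      (contDiff_apply ℝ ℝ i)

theorem isMixedDerivSystem_cellDeriv (d : G.Data k) (c : G.Cell) (β : Fin p → ℕ)
    (s : Set (Fin p → ℝ)) : IsMixedDerivSystem β (G.cellDeriv d c) s where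
  continuousOn γ _ := (G.contDiff_cellDeriv d c γ 0).continuous.continuousOn
  hasDerivAt γ _ i _ x _ := by
    refine hasDerivWithinAt_univ.1 (hasDerivWithinAt_tensorSum _ fun l => ?_)
    rw [Function.iterate_succ_apply']
    exact (Polynomial.hasDerivAt _ (x i)).hasDerivWithinAt

theorem eqOn_interpolant_splineDeriv (d : G.Data k) :
    EqOn (G.interpolant k d) (G.splineDeriv d 0) G.domain := fun x hx => by
  have h := G.exists_mem_closedCell hx
  rw [interpolant, dif_pos h, cellInterpolant_eq_cellDeriv,
    G.splineDeriv_eq_cellDeriv d (γ := 0) (fun _ => k.zero_le) h.choose_spec]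

theorem eqOn_interpolant_cellDeriv (d : G.Data k) (c : G.Cell) :
    EqOn (G.interpolant k d) (G.cellDeriv d c 0) (G.openCell c) := fun x hx => by
  rw [G.eqOn_interpolant_splineDeriv d (G.openCell_subset_domain c hx),
    G.splineDeriv_eq_cellDeriv d (γ := 0) (fun _ => k.zero_le) (G.openCell_subset_closedCell c hx)]

theorem eqOn_mixedDeriv_interpolant_cellDeriv (d : G.Data k) (c : G.Cell) (γ : Fin p → ℕ) :
    EqOn (G.mixedDeriv γ (G.interpolant k d)) (G.cellDeriv d c γ) (G.openCell c) :=
  eqOn_mixedDeriv_of_isMixedDerivSystem (G.isMixedDerivSystem_cellDeriv d c γ _)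
    (G.isOpen_openCell c) (G.openCell_subset_domain c) (G.eqOn_interpolant_cellDeriv d c)

theorem eqOn_mixedDeriv_interpolant_splineDeriv (d : G.Data k) {γ : Fin p → ℕ}
    (hγ : ∀ i, γ i ≤ k) :
    EqOn (G.mixedDeriv γ (G.interpolant k d)) (G.splineDeriv d γ) G.domain :=
  G.eqOn_mixedDeriv_of_hasDerivWithinAt Subset.rfl (fun _ _ => self_mem_nhdsWithin)
    (G.eqOn_interpolant_splineDeriv d) fun _ _ i hi x _ => hasDerivWithinAt_tensorSum _ fun l =>
      hasDerivWithinAt_hermiteSpline (G.numCells_pos i) (G.node_strictMono i) (l.2 i).is_le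
        (hi.trans_le (hγ i)) (l.1 i) (x i)

theorem gridData_interpolant (d : G.Data k) : G.gridData k (G.interpolant k d) = d := by
  funext m α
  rw [gridData, G.eqOn_mixedDeriv_interpolant_splineDeriv d (fun i => (α i).is_le)
    (G.point_mem_domain m), splineDeriv_point]

theorem cellwiseSmooth_interpolant (d : G.Data k) (r : WithTop ℕ∞) :
    G.CellwiseSmooth r (G.interpolant k d) := fun c =>
  (G.contDiff_cellDeriv d c 0 r).contDiffOn.congr (G.eqOn_interpolant_cellDeriv d c)

theorem matchesData_interpolant (d : G.Data k) : G.MatchesData k d (G.interpolant k d) := by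
  intro c q α
  rw [← G.cellDeriv_point_vertex d c q α]
  refine Tendsto.congr' ?_
    ((G.contDiff_cellDeriv d c _ 0).continuous.continuousWithinAt (s := G.openCell c)).tendsto
  filter_upwards [self_mem_nhdsWithin] with x hx
  exact (G.eqOn_mixedDeriv_interpolant_cellDeriv d c _ hx).symm

end Interpolant

section Stability

theorem isCompact_closedCell (c : G.Cell) : IsCompact (G.closedCell c) :=
  isCompact_univ_pi fun _ => isCompact_Icc

theorem openCell_ae_eq_closedCell (c : G.Cell) : G.openCell c =ᵐ[volume] G.closedCell c := by
  rw [closedCell, pi_univ_Icc]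
  exact Measure.univ_pi_Ioo_ae_eq_Icc

theorem ae_restrict_closedCell_of_forall {c : G.Cell} {P : (Fin p → ℝ) → Prop}
    (h : ∀ x ∈ G.openCell c, P x) : ∀ᵐ x ∂volume.restrict (G.closedCell c), P x := by
  rw [← Measure.restrict_congr_set (G.openCell_ae_eq_closedCell c)]
  exact ae_restrict_of_forall_mem (G.isOpen_openCell c).measurableSet h

theorem sum_beta (p k : ℕ) : ∑ i, beta p k i = p * (k + 1) := by
  simp only [beta, Finset.sum_const, Finset.card_univ, Fintype.card_fin, smul_eq_mul]

theorem integrableOn_cellDeriv_mul (d : G.Data k) (c : G.Cell) (γ : Fin p → ℕ)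
    {F : (Fin p → ℝ) → ℝ} (hF : IntegrableOn F (G.closedCell c)) :
    IntegrableOn (fun x => G.cellDeriv d c γ x * F x) (G.closedCell c) :=
  hF.continuousOn_mul (G.contDiff_cellDeriv d c γ 0).continuous.continuousOn
    (G.isCompact_closedCell c)

theorem integrableOn_cellDeriv (d : G.Data k) (c : G.Cell) (γ : Fin p → ℕ) :
    IntegrableOn (G.cellDeriv d c γ) (G.closedCell c) :=
  (G.contDiff_cellDeriv d c γ 0).continuous.continuousOn.integrableOn_compact
    (G.isCompact_closedCell c)

theorem integrableOn_sq_cellDeriv (d : G.Data k) (c : G.Cell) (γ : Fin p → ℕ) :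
    IntegrableOn (fun x => G.cellDeriv d c γ x ^ 2) (G.closedCell c) :=
  ((G.contDiff_cellDeriv d c γ 0).continuous.pow 2).continuousOn.integrableOn_compact
    (G.isCompact_closedCell c)

theorem iterate_derivative_derivative_hermitePiece_eq_zero (c : G.Cell) (m : G.Index)
    (α : Fin p → Fin (k + 1)) (i : Fin p) : Polynomial.derivative^[beta p k i]
      (Polynomial.derivative^[beta p k i] (hermitePiece k (G.node i) (m i) (α i) (c i))) = 0 := by
  rw [← Function.iterate_add_apply]
  refine Polynomial.iterate_derivative_eq_zero ?_
  have degree_le := hermitePiece_natDegree_le (t := G.node i) (α i).is_le (m i) (c i)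
  simp only [beta]
  omega

theorem setIntegral_cellDeriv_mul_eq_zero (d : G.Data k) {c : G.Cell}
    {g : (Fin p → ℕ) → (Fin p → ℝ) → ℝ} (hg : IsMixedDerivSystem (beta p k) g (G.openCell c))
    (hv : ∀ γ, (∀ i, γ i < k + 1) → ∀ q,
      Tendsto (g γ) (𝓝[G.openCell c] G.point (G.vertex c q)) (𝓝 0))
    (hi : IntegrableOn (g (beta p k)) (G.closedCell c)) :
    ∫ x in G.closedCell c, G.cellDeriv d c (beta p k) x * g (beta p k) x = 0 := by
  set P : G.Index × (Fin p → Fin (k + 1)) → Fin p → ℝ[X] := fun l i =>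
    Polynomial.derivative^[beta p k i] (hermitePiece k (G.node i) (l.1 i) (l.2 i) (c i))
  have integrable : ∀ l, IntegrableOn (fun x => (∏ i, (P l i).eval (x i)) * g (beta p k) x)
      (G.closedCell c) := fun l =>
    hi.continuousOn_mul (continuous_prod_eval (P l)).continuousOn (G.isCompact_closedCell c)
  have orthogonal : ∀ l,
      ∫ x in G.closedCell c, (∏ i, (P l i).eval (x i)) * g (beta p k) x = 0 := by
    intro l
    rw [← setIntegral_congr_set (G.openCell_ae_eq_closedCell c), openCell,
      setIntegral_pi_Ioo_prod_eval_mul_eq_boundarySum (v := 0) (G.cellLo_lt_cellHi c)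
        (G.iterate_derivative_derivative_hermitePiece_eq_zero c l.1 l.2) hg
        (fun γ hγ q => G.point_vertex c q ▸ hv γ hγ q)
        ((integrable l).mono_set (G.openCell_subset_closedCell c)), boundarySum_zero]
  simp only [cellDeriv, tensorSum, Finset.sum_mul, mul_assoc]
  rw [integral_finsetSum _ fun l _ => (integrable l).const_mul _]
  exact Finset.sum_eq_zero fun l _ => by rw [integral_const_mul, orthogonal l, mul_zero]

section MatchingFunction

variable {G} {d : G.Data k} {ψ : (Fin p → ℝ) → ℝ}
  (hψ : G.CellwiseSmooth ((p * (k + 1) : ℕ) : WithTop ℕ∞) ψ) (hψd : G.MatchesData k d ψ)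
  (c : G.Cell)

include hψ

theorem CellwiseSmooth.contDiffOn_sum_beta :
    ContDiffOn ℝ ((∑ i, beta p k i : ℕ) : WithTop ℕ∞) ψ (G.openCell c) := by
  rw [sum_beta]
  exact hψ c

theorem CellwiseSmooth.aestronglyMeasurable_mixedDeriv :
    AEStronglyMeasurable (G.mixedDeriv (beta p k) ψ) (volume.restrict (G.closedCell c)) := by
  rw [← Measure.restrict_congr_set (G.openCell_ae_eq_closedCell c)]
  exact ((isMixedDerivSystem_mixedDeriv (G.isOpen_openCell c) (G.openCell_subset_domain c)
    (hψ.contDiffOn_sum_beta c)).continuousOn _ le_rfl).aestronglyMeasurable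
      (G.isOpen_openCell c).measurableSet

theorem CellwiseSmooth.eqOn_mixedDeriv_sub_interpolant (d : G.Data k) :
    EqOn (G.mixedDeriv (beta p k) fun x => ψ x - G.interpolant k d x)
      (G.mixedDeriv (beta p k) ψ - G.cellDeriv d c (beta p k)) (G.openCell c) := fun x hx => by
  rw [eqOn_mixedDeriv_sub (G.isOpen_openCell c) (G.openCell_subset_domain c)
    (hψ.contDiffOn_sum_beta c) (G.cellwiseSmooth_interpolant d _ c) hx, Pi.sub_apply, Pi.sub_apply,
    G.eqOn_mixedDeriv_interpolant_cellDeriv d c _ hx]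

include hψd

theorem MatchesData.setIntegral_cellDeriv_mul_sub_eq_zero
    (hi : IntegrableOn (G.mixedDeriv (beta p k) ψ) (G.closedCell c)) :
    ∫ x in G.closedCell c, G.cellDeriv d c (beta p k) x *
      (G.mixedDeriv (beta p k) ψ - G.cellDeriv d c (beta p k)) x = 0 := by
  have tendsto_vertex : ∀ γ : Fin p → ℕ, (∀ i, γ i < k + 1) → ∀ q,
      Tendsto (G.mixedDeriv γ ψ - G.cellDeriv d c γ)
        (𝓝[G.openCell c] G.point (G.vertex c q)) (𝓝 0) := by
    intro γ hγ q
    have cellDeriv_tendsto :=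
      ((G.contDiff_cellDeriv d c γ 0).continuous.continuousWithinAt (s := G.openCell c)
        (x := G.point (G.vertex c q))).tendsto
    rw [G.cellDeriv_point_vertex d c q fun i => ⟨γ i, hγ i⟩] at cellDeriv_tendsto
    exact sub_self (d _ _) ▸ (hψd c q fun i => ⟨γ i, hγ i⟩).sub cellDeriv_tendsto
  exact G.setIntegral_cellDeriv_mul_eq_zero d
    ((isMixedDerivSystem_mixedDeriv (G.isOpen_openCell c) (G.openCell_subset_domain c)
      (hψ.contDiffOn_sum_beta c)).sub (G.isMixedDerivSystem_cellDeriv d c _ _))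
    tendsto_vertex (hi.sub (G.integrableOn_cellDeriv d c _))

theorem MatchesData.orthogonality
    (hi : IntegrableOn (G.mixedDeriv (beta p k) ψ) (G.closedCell c)) :
    IntegrableOn (fun x => G.mixedDeriv (beta p k) (G.interpolant k d) x *
        G.mixedDeriv (beta p k) (fun y => ψ y - G.interpolant k d y) x) (G.closedCell c) ∧
      ∫ x in G.closedCell c, G.mixedDeriv (beta p k) (G.interpolant k d) x *
        G.mixedDeriv (beta p k) (fun y => ψ y - G.interpolant k d y) x = 0 := by
  have ae_eq : (fun x => G.mixedDeriv (beta p k) (G.interpolant k d) x *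
      G.mixedDeriv (beta p k) (fun y => ψ y - G.interpolant k d y) x)
      =ᵐ[volume.restrict (G.closedCell c)] fun x => G.cellDeriv d c (beta p k) x *
        (G.mixedDeriv (beta p k) ψ - G.cellDeriv d c (beta p k)) x :=
    G.ae_restrict_closedCell_of_forall fun x hx => congrArg₂ (· * ·)
      (G.eqOn_mixedDeriv_interpolant_cellDeriv d c _ hx)
      (hψ.eqOn_mixedDeriv_sub_interpolant c d hx)
  refine ⟨Integrable.congr (G.integrableOn_cellDeriv_mul d c _
    (hi.sub (G.integrableOn_cellDeriv d c _))) ae_eq.symm, ?_⟩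
  rw [integral_congr_ae ae_eq, hψd.setIntegral_cellDeriv_mul_sub_eq_zero hψ c hi]

theorem MatchesData.lintegral_sq_cellDeriv_le :
    ∫⁻ x in G.closedCell c, ENNReal.ofReal (G.cellDeriv d c (beta p k) x ^ 2) ≤
      ∫⁻ x in G.closedCell c, ENNReal.ofReal (G.mixedDeriv (beta p k) ψ x ^ 2) := by
  by_cases htop : ∫⁻ x in G.closedCell c, ENNReal.ofReal (G.mixedDeriv (beta p k) ψ x ^ 2) = ⊤
  · rw [htop]
    exact le_top
  have measurable := hψ.aestronglyMeasurable_mixedDeriv c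
  have sq_integrable : IntegrableOn (fun x => G.mixedDeriv (beta p k) ψ x ^ 2) (G.closedCell c) :=
    ⟨measurable.pow 2, (hasFiniteIntegral_iff_ofReal (ae_of_all _ fun x => sq_nonneg _)).2
      (lt_top_iff_ne_top.2 htop)⟩
  have : IsFiniteMeasure (volume.restrict (G.closedCell c)) :=
    isFiniteMeasure_restrict.2 (G.isCompact_closedCell c).measure_ne_top
  have integrable : IntegrableOn (G.mixedDeriv (beta p k) ψ) (G.closedCell c) :=
    ((memLp_two_iff_integrable_sq measurable).2 sq_integrable).integrable one_le_two
  exact lintegral_sq_le_of_integral_mul_sub_eq_zero (G.integrableOn_sq_cellDeriv d c _)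
    (G.integrableOn_cellDeriv_mul d c _ (integrable.sub (G.integrableOn_cellDeriv d c _)))
    (hψd.setIntegral_cellDeriv_mul_sub_eq_zero hψ c integrable)

end MatchingFunction

theorem pairwise_disjoint_openCell : Pairwise (Function.onFun Disjoint G.openCell) := by
  intro c c' hne
  obtain ⟨i, hi⟩ := Function.ne_iff.1 hne
  exact disjoint_univ_pi.2
    ⟨i, pairwise_disjoint_Ioo_castSucc_succ (G.node_strictMono i).monotone hi⟩

theorem domain_eq_iUnion_closedCell : G.domain = ⋃ c, G.closedCell c :=
  Subset.antisymm (fun _ hx => mem_iUnion.2 (G.exists_mem_closedCell hx))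
    (iUnion_subset G.closedCell_subset_domain)

theorem stability_eq_sum (ψ : (Fin p → ℝ) → ℝ) : G.stability k ψ =
    ∑ c, ∫⁻ x in G.closedCell c, ENNReal.ofReal (G.mixedDeriv (beta p k) ψ x ^ 2) := by
  rw [stability, domain_eq_iUnion_closedCell, lintegral_iUnion₀
    (fun c => (G.isCompact_closedCell c).measurableSet.nullMeasurableSet), tsum_fintype]
  exact fun c c' hne => (G.pairwise_disjoint_openCell hne).aedisjoint.congr
    (G.openCell_ae_eq_closedCell c).symm (G.openCell_ae_eq_closedCell c').symm

theorem stability_interpolant (d : G.Data k) : G.stability k (G.interpolant k d) =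
    ∑ c, ∫⁻ x in G.closedCell c, ENNReal.ofReal (G.cellDeriv d c (beta p k) x ^ 2) := by
  rw [stability_eq_sum]
  refine Finset.sum_congr rfl fun c _ => lintegral_congr_ae ?_
  refine G.ae_restrict_closedCell_of_forall fun x hx => ?_
  beta_reduce
  rw [G.eqOn_mixedDeriv_interpolant_cellDeriv d c _ hx]

theorem stability_interpolant_lt_top (d : G.Data k) : G.stability k (G.interpolant k d) < ⊤ := by
  rw [stability_interpolant]
  exact ENNReal.sum_lt_top.2 fun c _ => (G.integrableOn_sq_cellDeriv d c _).setLIntegral_lt_top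

theorem stability_interpolant_le {d : G.Data k} {ψ : (Fin p → ℝ) → ℝ}
    (hψ : G.CellwiseSmooth ((p * (k + 1) : ℕ) : WithTop ℕ∞) ψ) (hψd : G.MatchesData k d ψ) :
    G.stability k (G.interpolant k d) ≤ G.stability k ψ := by
  rw [stability_interpolant, stability_eq_sum]
  exact Finset.sum_le_sum fun c _ => hψd.lintegral_sq_cellDeriv_le hψ c

end Stability

end RectGrid

end HermiteStability

theorem mainTheorem3_general {p k : ℕ} (G : RectGrid p) (d : G.Data k) :
    (G.CellwiseSmooth ∞ (G.interpolant k d) ∧ G.MatchesData k d (G.interpolant k d) ∧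
      G.gridData k (G.interpolant k d) = d ∧ G.stability k (G.interpolant k d) < ⊤) ∧
    ∀ ψ : (Fin p → ℝ) → ℝ, G.CellwiseSmooth ((p * (k + 1) : ℕ) : WithTop ℕ∞) ψ →
      G.MatchesData k d ψ →
      G.stability k (G.interpolant k d) ≤ G.stability k ψ ∧
      ∀ c : G.Cell,
        MeasureTheory.IntegrableOn (G.mixedDeriv (RectGrid.beta p k) ψ) (G.closedCell c) →
        MeasureTheory.IntegrableOn (fun x =>
            G.mixedDeriv (RectGrid.beta p k) (G.interpolant k d) x *
              G.mixedDeriv (RectGrid.beta p k) (fun y => ψ y - G.interpolant k d y) x)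
          (G.closedCell c) ∧
        ∫ x in G.closedCell c, G.mixedDeriv (RectGrid.beta p k) (G.interpolant k d) x *
          G.mixedDeriv (RectGrid.beta p k) (fun y => ψ y - G.interpolant k d y) x = 0 :=
  ⟨⟨G.cellwiseSmooth_interpolant d ∞, G.matchesData_interpolant d, G.gridData_interpolant d,
    G.stability_interpolant_lt_top d⟩,
    fun _ hψ hψd => ⟨G.stability_interpolant_le hψ hψd, fun c => hψd.orthogonality hψ c⟩⟩

theorem mainTheorem3 (p k : ℕ) (G : RectGrid p) (φ : (Fin p → ℝ) → ℝ)
    (hφ : G.CellwiseSmooth ((p * (k + 1) : ℕ) : WithTop ℕ∞) φ)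
    (hφd : G.MatchesData k (G.gridData k φ) φ) :
    -- the Hermite interpolant is smooth in each cell and satisfies the constraints
    (G.CellwiseSmooth ∞ (G.hermite k φ) ∧
      G.MatchesData k (G.gridData k φ) (G.hermite k φ) ∧
      G.gridData k (G.hermite k φ) = G.gridData k φ ∧
      G.stability k (G.hermite k φ) < ⊤) ∧
    -- it does not increase the stability functional
    G.stability k (G.hermite k φ) ≤ G.stability k φ ∧
    -- it is a minimizer among the cellwise smooth functions with the same data
    (∀ ψ : (Fin p → ℝ) → ℝ, G.CellwiseSmooth ((p * (k + 1) : ℕ) : WithTop ℕ∞) ψ →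
      G.MatchesData k (G.gridData k φ) ψ →
      G.stability k (G.hermite k φ) ≤ G.stability k ψ) ∧
    -- orthogonality in each cell
    (∀ c : G.Cell,
      MeasureTheory.IntegrableOn (G.mixedDeriv (RectGrid.beta p k) φ) (G.closedCell c) →
      MeasureTheory.IntegrableOn (fun x => G.mixedDeriv (RectGrid.beta p k) (G.hermite k φ) x *
          G.mixedDeriv (RectGrid.beta p k) (fun y => φ y - G.hermite k φ y) x)
        (G.closedCell c) ∧
      ∫ x in G.closedCell c, G.mixedDeriv (RectGrid.beta p k) (G.hermite k φ) x *
          G.mixedDeriv (RectGrid.beta p k) (fun y => φ y - G.hermite k φ y) x = 0) := by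
  obtain ⟨constraints, optimal⟩ := mainTheorem3_general G (G.gridData k φ)
  exact ⟨constraints, (optimal φ hφ hφd).1, fun ψ hψ hψd => (optimal ψ hψ hψd).1,
    (optimal φ hφ hφd).2⟩
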